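/- **Theorem 1.8.** Let $d \ge 2$ be an integer and $k = d+1$. Write $\|x\| = \min\{|x-a| : a \in \mathbb{Z}\}$. *Littlewood's conjecture in $d$ dimensions* is the assertion that $$\liminf_{n\to\infty} n\,\|n\alpha_1\|\cdots\|n\alpha_d\| = 0 \qquad \text{for every } \boldsymbol\alpha \in \mathbb{R}^d.$$ Let $\mathcal G_{k,3}$ be the set of $\boldsymbol\omega = (\omega_1,\dots,\omega_k)$ such that, for each $i\le k$, the function $\omega_i:\mathbb{R}\to[0,\infty)$ is $C^3$, $\mathrm{supp}(\omega_i)\subseteq[-2,2]$, $\widehat\omega_i \ge 0$ and $\widehat\omega_i(0)>0$, where $\widehat\omega_i(\xi)=\int_{\mathbb R}\omega_i(x)e^{-2\pi \mathrm i\xi x}\,\mathrm dx$. For $\boldsymbol\omega\in\mathcal G_{k,3}$, $\boldsymbol\alpha\in\mathbb{R}^d$ and $N\in\mathbb N=\{1,2,\dots\}$, the $C^3$-smooth discrepancy of the Kronecker sequence of $\boldsymbol\alpha$ (that is, of $(n\alpha_1,\dots,n\alpha_d) \bmod 1$) is $$D_{\boldsymbol\omega}(\boldsymbol\alpha;N)=\sup_{\boldsymbol\gamma\in\mathbb{R}^d,\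 \boldsymbol\rho\in(0,1/2)^d}\left|\sum_{\mathbf a\in\mathbb{Z}^k}\omega_k\left(\frac{a_k}{N}\right)\prod_{i\le d}\omega_i\left(\frac{a_i+a_k\alpha_i-\gamma_i}{\rho_i}\right)-\widehat\omega_1(0)\cdots\widehat\omega_k(0)\,\rho_1\cdots\rho_d N\right|.$$ Then the following are equivalent: 1. Littlewood's conjecture holds in $d$ dimensions; 2. every $d$-dimensional Kronecker sequence has unbounded $C^3$-smooth discrepancy for every weight: for all $\boldsymbol\alpha\in\mathbb{R}^d$ and all $\boldsymbol\omega\in\mathcal G_{k,3}$, the function $N\mapsto D_{\boldsymbol\omega}(\boldsymbol\alpha;N)$ is unbounded on $\mathbb N$; 3. every $d$-dimensional Kronecker sequence has unbounded $C^3$-smooth discrepancy for some weight: for every $\boldsymbol\alpha\in\mathbb{R}^d$ there is $\boldsymbol\omega\in\mathcal G_{k,3}$ such that $N\mapsto D_{\boldsymbol\omega}(\boldsymbol\alpha;N)$ is unbounded on $\mathbb N$. -/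

import Mathlib

open scoped FourierTransform ComplexOrder

namespace SmoothDiscrepancy

/-- Distance `‖x‖` from a real number to the nearest integer. -/
noncomputable def distInt (x : ℝ) : ℝ := |x - round x|

/-- `‖x‖ = min {|x - a| : a ∈ ℤ}`. -/
theorem isLeast_distInt (x : ℝ) :
    IsLeast (Set.range fun a : ℤ => |x - (a : ℝ)|) (distInt x) :=
  ⟨⟨round x, rfl⟩, by rintro _ ⟨a, rfl⟩; exact round_le x a⟩

/-- Littlewood's conjecture in `d` dimensions:
`liminf_{n → ∞} n ‖n α₁‖ ⋯ ‖n α_d‖ = 0` for every `α ∈ ℝ^d`.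
The lower limit is taken in the extended reals, so that no boundedness is presupposed. -/
def LittlewoodConjecture (d : ℕ) : Prop :=
  ∀ α : Fin d → ℝ,
    Filter.liminf
      (fun n : ℕ => (((n : ℝ) * ∏ i, distInt ((n : ℝ) * α i) : ℝ) : EReal)) Filter.atTop = 0

/-- The Fourier transform `ξ ↦ ∫ w(x) e(-ξ x) dx`, with `e(z) = exp(2πiz)`,
of a real-valued function on the real line. -/
noncomputable def fourierHat (w : ℝ → ℝ) : ℝ → ℂ := 𝓕 (fun x : ℝ => (w x : ℂ))

theorem fourierHat_apply (w : ℝ → ℝ) (ξ : ℝ) :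
    fourierHat w ξ = ∫ x : ℝ, (w x : ℂ) * Complex.exp (2 * Real.pi * Complex.I * (-ξ * x)) := by
  rw [fourierHat, Real.fourier_real_eq_integral_exp_smul]
  refine MeasureTheory.integral_congr_ae (Filter.Eventually.of_forall fun x => ?_)
  simp only [smul_eq_mul]
  rw [mul_comm]
  congr 2
  push_cast
  ring

/-- The class `𝒢_{k,ℓ}` of `k`-tuples `ω = (ω₁, …, ω_k)` of non-negative `C^ℓ` functions on the
real line, supported in `[-2, 2]`, whose Fourier transforms are real and non-negative, and positive
at the origin. (The order on `ℂ` is the one in which `0 ≤ z` means that `z` is real and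
non-negative.) -/
structure IsWeight {k : ℕ} (ℓ : ℕ) (ω : Fin k → ℝ → ℝ) : Prop where
  nonneg : ∀ i x, 0 ≤ ω i x
  tsupport_subset : ∀ i, tsupport (ω i) ⊆ Set.Icc (-2) 2
  contDiff : ∀ i, ContDiff ℝ ℓ (ω i)
  fourierHat_nonneg : ∀ i ξ, 0 ≤ fourierHat (ω i) ξ
  fourierHat_zero_pos : ∀ i, 0 < fourierHat (ω i) 0

/-- A test box `(γ; ρ)` with centre `γ ∈ ℝ^d` and `ρ ∈ (0, 1/2)^d`. -/
structure Box (d : ℕ) where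
  γ : Fin d → ℝ
  ρ : Fin d → ℝ
  ρ_mem : ∀ i, ρ i ∈ Set.Ioo (0 : ℝ) (1 / 2)

/-- `vol(𝔅; N) = ρ₁ ⋯ ρ_d N`. -/
noncomputable def Box.vol {d : ℕ} (B : Box d) (N : ℕ) : ℝ := (∏ i, B.ρ i) * N

/-- `ℭ(ω) = ω̂₁(0) ⋯ ω̂_k(0)`, a real number since every `ω̂_i(0) = ∫ ω_i` is real. -/
noncomputable def expectWeight {k : ℕ} (ω : Fin k → ℝ → ℝ) : ℝ :=
  ∏ i, (fourierHat (ω i) 0).re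

/-- The smooth discrepancy of the Kronecker sequence of `α` in the box `𝔅`: the smooth point count
minus the expected count. The last coordinate of `a ∈ ℤ^(d+1)` is the index of the sequence. For
`N ≥ 1` and compactly supported weights only finitely many summands are non-zero. -/
noncomputable def boxDiscrepancy {d : ℕ} (ω : Fin (d + 1) → ℝ → ℝ) (α : Fin d → ℝ)
    (B : Box d) (N : ℕ) : ℝ :=
  (∑' a : Fin (d + 1) → ℤ,
      ω (Fin.last d) ((a (Fin.last d) : ℝ) / N) *
        ∏ i : Fin d, ω i.castSucc
          (((a i.castSucc : ℝ) + (a (Fin.last d) : ℝ) * α i - B.γ i) / B.ρ i))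
    - expectWeight ω * B.vol N

/-- The smooth discrepancy `D_ω(α; N)`: the supremum of `|D_ω(𝔅; N)|` over all test boxes, as an
extended real number. -/
noncomputable def smoothDiscrepancy {d : ℕ} (ω : Fin (d + 1) → ℝ → ℝ) (α : Fin d → ℝ)
    (N : ℕ) : EReal :=
  ⨆ B : Box d, ((|boxDiscrepancy ω α B N| : ℝ) : EReal)

/-- `N ↦ D_ω(α; N)` is unbounded on the positive integers. -/
def HasUnboundedDiscrepancy {d : ℕ} (ω : Fin (d + 1) → ℝ → ℝ) (α : Fin d → ℝ) : Prop :=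
  ∀ C : ℝ, ∃ N : ℕ, 1 ≤ N ∧ (C : EReal) < smoothDiscrepancy ω α N

end SmoothDiscrepancy

namespace SmoothDiscrepancy

/-! The proof is the cycle 1 → 2 → 3 → 1; the step 2 → 3 only needs one weight to exist
(`exists_isWeight`).

From 1 to 2: if `h ∏ ‖h αᵢ‖` is tiny, the first multiples of `h` all stay near the origin. In the
box centred at `0` with radii slightly above `K ‖h αᵢ‖` and with `N = K h`, the smooth count is at
least a constant times `K`, because each `ωᵢ` is bounded below near `0`, while the expected count,
about `K ^ (d + 1) h ∏ ‖h αᵢ‖` up to a constant, is at most `1`. Letting `K` grow makes the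
discrepancy unbounded (`hasUnboundedDiscrepancy_of_small_values`).

From 3 to 1, by contraposition: a counterexample `α` to Littlewood satisfies `n ∏ ‖n αᵢ‖ ≥ c > 0`
for all `n ≥ 1`. Transference (`exists_dual_bound`) gives a similar bound for the form `m - ∑ bᵢ
αᵢ`. Poisson summation (`IsWeight.tsum_count_eq`) writes the discrepancy as a sum over the non-zero
points `(b, m)` of the dual lattice. The dual bound limits how many of these, after rescaling by the
box, share a unit cell, and keeps all of them away from the origin in a multiplicative sense. With
the cubic decay of `ω̂ᵢ` this bounds the sum uniformly over boxes and `N`, for every weight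
(`IsWeight.exists_abs_boxDiscrepancy_le`). -/

theorem distInt_le (x : ℝ) (a : ℤ) : distInt x ≤ |x - a| := round_le x a

theorem distInt_nonneg (x : ℝ) : 0 ≤ distInt x := abs_nonneg _

theorem distInt_nat_mul_le (q : ℕ) (x : ℝ) : distInt (q * x) ≤ q * distInt x := by
  refine (distInt_le _ (q * round x)).trans (le_of_eq ?_)
  rw [distInt, ← Nat.abs_cast q, ← abs_mul, Nat.abs_cast]
  push_cast
  ring_nf

/-! ### Dirichlet's theorem and transference -/

/-- Dirichlet's theorem on simultaneous approximation, with a separate quality in each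
coordinate. -/
theorem exists_simultaneous_approx {ι : Type*} [Fintype ι] (α : ι → ℝ) (M : ι → ℕ)
    (hM : ∀ i, 0 < M i) :
    ∃ h : ℕ, 0 < h ∧ h ≤ ∏ i, M i ∧ ∃ a : ι → ℤ, ∀ i, |h * α i - a i| < 1 / M i := by
  classical
  have hfl : ∀ (n : ℕ) i, ⌊Int.fract (n * α i) * M i⌋₊ < M i := by
    intro n i
    have hpos : (0 : ℝ) < M i := by exact_mod_cast hM i
    rw [Nat.floor_lt (mul_nonneg (Int.fract_nonneg _) hpos.le)]
    exact mul_lt_of_lt_one_left hpos (Int.fract_lt_one _)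
  -- Pigeonhole: `∏ M i + 1` multiples of `α` modulo one fall into `∏ M i` boxes with sides `1 / M
  -- i`.
  let f : Fin (∏ i, M i + 1) → (∀ i, Fin (M i)) := fun n i => ⟨_, hfl n i⟩
  have key : ∀ p q : Fin (∏ i, M i + 1), p < q → f p = f q →
      ∃ h : ℕ, 0 < h ∧ h ≤ ∏ i, M i ∧ ∃ a : ι → ℤ, ∀ i, |h * α i - a i| < 1 / M i := by
    intro p q hpq hf
    refine ⟨q - p, Nat.sub_pos_of_lt hpq, by have := q.2; omega,
      fun i => ⌊(q : ℕ) * α i⌋ - ⌊(p : ℕ) * α i⌋, fun i => ?_⟩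
    have hpos : (0 : ℝ) < M i := by exact_mod_cast hM i
    have hfi : ⌊Int.fract ((p : ℕ) * α i) * M i⌋₊ = ⌊Int.fract ((q : ℕ) * α i) * M i⌋₊ :=
      congrArg Fin.val (congrFun hf i)
    have h1 := Nat.floor_le (mul_nonneg (Int.fract_nonneg ((p : ℕ) * α i)) hpos.le)
    have h2 := Nat.lt_floor_add_one (Int.fract ((p : ℕ) * α i) * M i)
    have h3 := Nat.floor_le (mul_nonneg (Int.fract_nonneg ((q : ℕ) * α i)) hpos.le)
    have h4 := Nat.lt_floor_add_one (Int.fract ((q : ℕ) * α i) * M i)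
    rw [hfi] at h1 h2
    rw [lt_div_iff₀ hpos]
    have : (((q : ℕ) - (p : ℕ) : ℕ) * α i - ((⌊(q : ℕ) * α i⌋ - ⌊(p : ℕ) * α i⌋ : ℤ) : ℝ)) * M i
        = Int.fract ((q : ℕ) * α i) * M i - Int.fract ((p : ℕ) * α i) * M i := by
      rw [Nat.cast_sub (le_of_lt hpq), Int.fract, Int.fract]
      push_cast
      ring
    have habs : |Int.fract ((q : ℕ) * α i) * M i - Int.fract ((p : ℕ) * α i) * M i| < 1 := by
      rw [abs_lt]
      constructor <;> linarith
    rwa [← this, abs_mul, abs_of_pos hpos] at habs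
  obtain ⟨p, q, hpq, hf⟩ := Fintype.exists_ne_map_eq_of_card_lt f (by simp)
  rcases lt_or_gt_of_ne hpq with h | h
  · exact key p q h hf
  · exact key q p h hf.symm

/-- Transference: if the products `n ∏ |n αᵢ - aᵢ|` are bounded away from zero, then so are the
products of the dual linear form. -/
theorem exists_dual_bound {d : ℕ} (α : Fin d → ℝ) {c : ℝ} (hc : 0 < c)
    (hα : ∀ n : ℕ, 0 < n → ∀ a : Fin d → ℤ, c ≤ n * ∏ i, |n * α i - a i|) :
    ∃ c' : ℝ, 0 < c' ∧ ∀ (b : Fin d → ℤ) (m : ℤ), (b ≠ 0 ∨ m ≠ 0) →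
      c' ≤ |m - ∑ i, b i * α i| * ∏ i, max 1 |(b i : ℝ)| := by
  classical
  set Q : ℕ := 2 * d + 1 with hQ
  have hQ0 : (0 : ℝ) < Q := by positivity
  -- The argument ends with a product at most `Q ^ d / T`, which has to be below `c`.
  obtain ⟨T, hT⟩ := exists_nat_gt (max 1 ((Q : ℝ) ^ d / c))
  have hT1 : (1 : ℝ) < T := (le_max_left _ _).trans_lt hT
  have hT2 : (Q : ℝ) ^ d / c < T := (le_max_right _ _).trans_lt hT
  have hT0 : (0 : ℝ) < T := by linarith
  -- The `1` serves `b = 0`; the other entry is chosen to force `h * |L| ≤ 1 / (2 * T)`.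
  refine ⟨min 1 (1 / (2 * Q ^ d * T ^ d)), by positivity, fun b m hbm => ?_⟩
  by_cases hb : b = 0
  · have hm : m ≠ 0 := by tauto
    subst hb
    simp only [Pi.zero_apply, Int.cast_zero, zero_mul, Finset.sum_const_zero, sub_zero, abs_zero]
    have : (1 : ℝ) ≤ |(m : ℝ)| := by exact_mod_cast Int.one_le_abs hm
    simp [this]
  obtain ⟨i₀, hi₀⟩ : ∃ i, b i ≠ 0 := Function.ne_iff.mp hb
  refine (min_le_right _ _).trans ?_
  by_contra! hlt
  set L : ℝ := m - ∑ i, b i * α i with hL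
  let B : Fin d → ℕ := fun i => max 1 (b i).natAbs
  have hB : ∀ i, (B i : ℝ) = max 1 |(b i : ℝ)| := by
    intro i; simp [B]
  have hB1 : ∀ i, (1 : ℝ) ≤ B i := fun i => by rw [hB]; exact le_max_left _ _
  have hBb : ∀ i, |(b i : ℝ)| ≤ B i := fun i => by rw [hB]; exact le_max_right _ _
  simp_rw [← hB] at hlt
  set P : ℝ := ∏ i, (B i : ℝ) with hP
  have hP0 : 0 < P := Finset.prod_pos fun i _ => by linarith [hB1 i]
  -- The factor `T` is requested everywhere except at `i₀`, so that `h ≤ Q ^ d * P * T ^ (d - 1)`.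
  -- The linear relation below returns the missing factor at `i₀`, a net gain of `T` over Dirichlet.
  let M : Fin d → ℕ := fun i => Q * B i * (if i = i₀ then 1 else T)
  have hTn : 0 < T := by exact_mod_cast hT0
  have hM : ∀ i, 0 < M i := by
    intro i
    have : 0 < B i := by exact_mod_cast (by linarith [hB1 i] : (0 : ℝ) < B i)
    simp only [M]
    split_ifs <;> positivity
  obtain ⟨h, h0, hR, a, ha⟩ := exists_simultaneous_approx α M hM
  have hRT : ((∏ i, M i : ℕ) : ℝ) * T = Q ^ d * P * T ^ d := by
    simp only [M, Finset.prod_mul_distrib, hP]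
    push_cast
    have : (∏ i : Fin d, (if i = i₀ then (1 : ℝ) else T)) * T = T ^ d := by
      rw [Finset.prod_ite, Finset.filter_ne', Finset.prod_const_one, one_mul, Finset.prod_const,
        Finset.card_erase_of_mem (Finset.mem_univ _), ← pow_succ]
      simp only [Finset.card_univ, Fintype.card_fin]
      congr 1
      have := i₀.pos
      omega
    rw [mul_assoc, this]
    simp
  have hhR : (h : ℝ) ≤ ((∏ i, M i : ℕ) : ℝ) := by exact_mod_cast hR
  set R : ℝ := ((∏ i, M i : ℕ) : ℝ) with hRdef
  have hRL : h * |L| ≤ 1 / (2 * T) := by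
    have h1 : |L| * P * (2 * Q ^ d * T ^ d) < 1 := by
      rwa [lt_div_iff₀ (by positivity)] at hlt
    rw [le_div_iff₀ (by positivity)]
    have : h * |L| * (2 * T) ≤ R * |L| * (2 * T) := by gcongr
    have h2 : R * |L| * (2 * T) = |L| * P * (2 * Q ^ d * T ^ d) := by
      linear_combination 2 * |L| * hRT
    linarith
  set y : Fin d → ℝ := fun i => h * α i - a i with hy
  have hyM : ∀ i, |(b i : ℝ)| * |y i| ≤ B i / M i := by
    intro i
    calc |(b i : ℝ)| * |y i| ≤ B i * (1 / M i) :=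
          mul_le_mul (hBb i) (ha i).le (abs_nonneg _) (by positivity)
      _ = B i / M i := by ring
  have hyi₀ : |(b i₀ : ℝ)| * |y i₀| ≤ 1 / Q := by
    refine (hyM i₀).trans (le_of_eq ?_)
    simp only [M, if_true]
    have := hB1 i₀
    push_cast
    field_simp
  have hyne : ∀ i, i ≠ i₀ → |(b i : ℝ)| * |y i| ≤ 1 / (Q * T) := by
    intro i hi
    refine (hyM i).trans (le_of_eq ?_)
    simp only [M, if_neg hi]
    have := hB1 i
    push_cast
    field_simp
  have hyall : ∀ i, |(b i : ℝ)| * |y i| ≤ 1 / Q := by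
    intro i
    by_cases hi : i = i₀
    · rw [hi]; exact hyi₀
    · refine (hyne i hi).trans ?_
      gcongr
      nlinarith
  have hdQ : (d : ℝ) * (1 / Q) < 1 / 2 := by
    rw [mul_one_div, div_lt_div_iff₀ hQ0 (by norm_num), hQ]
    push_cast
    linarith
  have hrel : ∑ i, b i * y i = ((h * m - ∑ i, b i * a i : ℤ) : ℝ) - h * L := by
    simp only [hy, hL]
    push_cast
    simp only [mul_sub, Finset.sum_sub_distrib, Finset.mul_sum]
    have : ∀ i, (b i : ℝ) * (h * α i) = h * (b i * α i) := fun i => by ring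
    simp only [this]
    ring
  have hT12 : 1 / (2 * (T : ℝ)) ≤ 1 / 2 := by
    gcongr
    linarith
  -- This integer equals `∑ b i * y i + h * L`. The choice `Q > 2 * d` makes the sum smaller than `1
  -- / 2`, so the integer vanishes.
  have hzero : (h * m - ∑ i, b i * a i : ℤ) = 0 := by
    rw [← Int.abs_lt_one_iff]
    have h1 : |∑ i, b i * y i| < 1 / 2 := by
      refine lt_of_le_of_lt (Finset.abs_sum_le_sum_abs _ _) (lt_of_le_of_lt ?_ hdQ)
      calc ∑ i, |b i * y i| ≤ ∑ _i : Fin d, 1 / (Q : ℝ) :=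
            Finset.sum_le_sum fun i _ => by rw [abs_mul]; exact hyall i
        _ = _ := by simp
    have h2 : |(h : ℝ) * L| ≤ 1 / 2 := by
      rw [abs_mul, Nat.abs_cast]
      exact hRL.trans hT12
    have h3 : |((h * m - ∑ i, b i * a i : ℤ) : ℝ)| < 1 := by
      have : ((h * m - ∑ i, b i * a i : ℤ) : ℝ) = ∑ i, b i * y i + h * L := by
        rw [hrel]; ring
      rw [this]
      refine (abs_add_le _ _).trans_lt ?_
      linarith
    exact_mod_cast h3
  rw [hzero, Int.cast_zero, zero_sub] at hrel
  -- Solve the relation `∑ b i * y i = -h * L` for its `i₀` term: everything else has size `1 / T`.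
  have hyi₀' : |(b i₀ : ℝ)| * |y i₀| ≤ 1 / T := by
    have h1 : b i₀ * y i₀ = -(h * L) - ∑ i ∈ Finset.univ.erase i₀, b i * y i := by
      rw [← hrel, ← Finset.add_sum_erase _ _ (Finset.mem_univ i₀)]
      ring
    have h2 : |∑ i ∈ Finset.univ.erase i₀, b i * y i| ≤ 1 / (2 * T) := by
      refine (Finset.abs_sum_le_sum_abs _ _).trans ?_
      calc ∑ i ∈ Finset.univ.erase i₀, |b i * y i|
          ≤ ∑ _i ∈ Finset.univ.erase i₀, 1 / ((Q : ℝ) * T) :=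
            Finset.sum_le_sum fun i hi => by
              rw [abs_mul]; exact hyne i (Finset.ne_of_mem_erase hi)
        _ ≤ ∑ _i : Fin d, 1 / ((Q : ℝ) * T) :=
            Finset.sum_le_sum_of_subset_of_nonneg (Finset.erase_subset _ _)
              fun _ _ _ => by positivity
        _ = d * (1 / Q) * (1 / T) := by simp; ring
        _ ≤ 1 / 2 * (1 / T) := by gcongr
        _ = _ := by ring
    rw [← abs_mul, h1]
    refine (abs_sub _ _).trans ?_
    rw [abs_neg, abs_mul, Nat.abs_cast]
    calc _ ≤ 1 / (2 * (T : ℝ)) + 1 / (2 * T) := add_le_add hRL h2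
      _ = _ := by field_simp; norm_num
  have hfin : ∀ i, |y i| ≤ 1 / (T * B i) := by
    intro i
    by_cases hi : i = i₀
    · subst hi
      have : (B i : ℝ) = |(b i : ℝ)| := by
        rw [hB, max_eq_right]
        exact_mod_cast Int.one_le_abs hi₀
      rw [this]
      rw [this.symm] at hyi₀' ⊢
      have := hB1 i
      rw [le_div_iff₀ (by positivity)]
      rw [le_div_iff₀ hT0] at hyi₀'
      linarith
    · refine (ha i).le.trans ?_
      have := hB1 i
      simp only [M, if_neg hi]
      push_cast
      have hQ1 : (1 : ℝ) ≤ Q := by rw [hQ]; push_cast; linarith [Nat.cast_nonneg (α := ℝ) d]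
      refine one_div_le_one_div_of_le (by positivity) ?_
      nlinarith [mul_nonneg (by linarith : (0 : ℝ) ≤ B i) hT0.le]
  have hcon := hα h h0 a
  have : h * ∏ i, |h * α i - a i| ≤ R * (1 / (T ^ d * P)) := by
    refine mul_le_mul hhR ?_ (Finset.prod_nonneg fun _ _ => abs_nonneg _) (by positivity)
    calc ∏ i, |h * α i - a i| ≤ ∏ i, 1 / (T * (B i : ℝ)) :=
          Finset.prod_le_prod (fun _ _ => abs_nonneg _) fun i _ => hfin i
      _ = 1 / (T ^ d * P) := by
          simp [Finset.prod_mul_distrib, hP]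
  have h5 : R * (1 / (T ^ d * P)) = Q ^ d / T := by
    rw [mul_one_div, div_eq_div_iff (by positivity) (by positivity), hRT]
    ring
  have h6 : (Q : ℝ) ^ d / T < c := by
    rw [div_lt_iff₀ hT0]
    rw [div_lt_iff₀ hc] at hT2
    linarith
  linarith

/-! ### Fourier decay of compactly supported `C³` functions -/

open MeasureTheory in
theorem integrable_iteratedDeriv_of_hasCompactSupport {f : ℝ → ℂ} {N : ℕ} (hf : ContDiff ℝ N f)
    (hs : HasCompactSupport f) {n : ℕ} (hn : n ≤ N) : Integrable (iteratedDeriv n f) := by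
  have hc : Continuous (iteratedDeriv n f) :=
    hf.continuous_iteratedDeriv n (by exact_mod_cast hn)
  refine hc.integrable_of_hasCompactSupport ?_
  have h := hs.iteratedFDeriv (𝕜 := ℝ) n
  rw [iteratedDeriv_eq_equiv_comp]
  exact h.comp_left (by simp)

/-- The Fourier transform of a compactly supported `C³` function decays cubically. -/
theorem exists_norm_fourier_le {f : ℝ → ℂ} (hf : ContDiff ℝ 3 f) (hs : HasCompactSupport f) :
    ∃ C : ℝ, 0 < C ∧ ∀ ξ, ‖𝓕 f ξ‖ ≤ C / (1 + |ξ|) ^ 3 := by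
  set A := ∫ x, ‖f x‖
  set A' := ∫ x, ‖iteratedDeriv 3 f x‖
  have hA : 0 ≤ A := MeasureTheory.integral_nonneg fun _ => norm_nonneg _
  have hA' : 0 ≤ A' := MeasureTheory.integral_nonneg fun _ => norm_nonneg _
  -- The `4` comes from `(1 + x) ^ 3 ≤ 4 * (1 + x ^ 3)` for `x ≥ 0`; the `1` makes the constant
  -- positive.
  refine ⟨4 * (A + A') + 1, by linarith, fun ξ => ?_⟩
  have h0 : ‖𝓕 f ξ‖ ≤ A := by
    rw [Real.fourier_eq]
    refine (MeasureTheory.norm_integral_le_integral_norm _).trans (le_of_eq ?_)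
    simp only [Circle.norm_smul, A]
  have h3 : ‖𝓕 (iteratedDeriv 3 f) ξ‖ ≤ A' := by
    rw [Real.fourier_eq]
    refine (MeasureTheory.norm_integral_le_integral_norm _).trans (le_of_eq ?_)
    simp only [Circle.norm_smul, A']
  have h4 := congrFun (Real.fourier_iteratedDeriv (N := 3) (n := 3) hf
    (fun n hn => integrable_iteratedDeriv_of_hasCompactSupport (N := 3) hf hs
      (by exact_mod_cast hn)) le_rfl) ξ
  rw [h4, norm_smul, norm_pow] at h3
  have h5 : ‖(2 * Real.pi * Complex.I * ξ : ℂ)‖ = 2 * Real.pi * |ξ| := by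
    simp [abs_of_pos Real.pi_pos]
  rw [h5] at h3
  have h6 : |ξ| ^ 3 * ‖𝓕 f ξ‖ ≤ A' := by
    refine le_trans ?_ h3
    gcongr
    nlinarith [Real.pi_gt_three, abs_nonneg ξ]
  rw [le_div_iff₀ (by positivity)]
  have h7 : (1 + |ξ|) ^ 3 ≤ 4 * (1 + |ξ| ^ 3) := by
    nlinarith [abs_nonneg ξ, mul_nonneg (by positivity : 0 ≤ 1 + |ξ|) (sq_nonneg (|ξ| - 1))]
  calc ‖𝓕 f ξ‖ * (1 + |ξ|) ^ 3 ≤ ‖𝓕 f ξ‖ * (4 * (1 + |ξ| ^ 3)) := by gcongr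
    _ = 4 * (‖𝓕 f ξ‖ + |ξ| ^ 3 * ‖𝓕 f ξ‖) := by ring
    _ ≤ _ := by linarith

theorem continuous_fourier {f : ℝ → ℂ} (hf : MeasureTheory.Integrable f) : Continuous (𝓕 f) :=
  VectorFourier.fourierIntegral_continuous Real.continuous_fourierChar
    (by exact continuous_inner) hf

theorem integrable_fourier {f : ℝ → ℂ} (hf : ContDiff ℝ 3 f) (hs : HasCompactSupport f) :
    MeasureTheory.Integrable (𝓕 f) := by
  obtain ⟨C, hC, h⟩ := exists_norm_fourier_le hf hs
  have hint := (integrable_one_add_norm (E := ℝ) (μ := MeasureTheory.volume) (r := 3)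
    (by simp)).const_mul C
  refine hint.mono' (continuous_fourier
    (hf.continuous.integrable_of_hasCompactSupport hs)).aestronglyMeasurable
    (Filter.Eventually.of_forall fun ξ => (h ξ).trans (le_of_eq ?_))
  rw [Real.rpow_neg (by positivity), Real.norm_eq_abs, div_eq_mul_inv]
  norm_cast

/-! ### Basic properties of weights -/

theorem IsWeight.hasCompactSupport {k : ℕ} {ω : Fin k → ℝ → ℝ} (hω : IsWeight 3 ω) (i : Fin k) :
    HasCompactSupport (ω i) :=
  isCompact_Icc.of_isClosed_subset (isClosed_tsupport _) (hω.tsupport_subset i)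

theorem IsWeight.hasCompactSupport_ofReal {k : ℕ} {ω : Fin k → ℝ → ℝ} (hω : IsWeight 3 ω)
    (i : Fin k) : HasCompactSupport fun x => (ω i x : ℂ) :=
  (hω.hasCompactSupport i).comp_left Complex.ofReal_zero

theorem IsWeight.contDiff_ofReal {k : ℕ} {ω : Fin k → ℝ → ℝ} (hω : IsWeight 3 ω)
    (i : Fin k) : ContDiff ℝ 3 fun x => (ω i x : ℂ) :=
  Complex.ofRealCLM.contDiff.comp (hω.contDiff i)

theorem IsWeight.eq_zero_of_lt {k : ℕ} {ω : Fin k → ℝ → ℝ} (hω : IsWeight 3 ω)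
    (i : Fin k) {x : ℝ} (hx : 2 < |x|) : ω i x = 0 := by
  by_contra h
  have := hω.tsupport_subset i (subset_tsupport _ h)
  rw [Set.mem_Icc, ← abs_le] at this
  linarith

theorem IsWeight.integrable {k : ℕ} {ω : Fin k → ℝ → ℝ} (hω : IsWeight 3 ω) (i : Fin k) :
    MeasureTheory.Integrable fun x => (ω i x : ℂ) :=
  (hω.contDiff_ofReal i).continuous.integrable_of_hasCompactSupport
    (hω.hasCompactSupport_ofReal i)

/-- By Fourier inversion `ωᵢ(0) = ∫ ω̂ᵢ`, the integral of a continuous non-negative function that is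
positive at `0`. -/
theorem IsWeight.apply_zero_pos {k : ℕ} {ω : Fin k → ℝ → ℝ} (hω : IsWeight 3 ω) (i : Fin k) :
    0 < ω i 0 := by
  have hint : MeasureTheory.Integrable (fourierHat (ω i)) :=
    integrable_fourier (hω.contDiff_ofReal i) (hω.hasCompactSupport_ofReal i)
  have hcont : Continuous (fourierHat (ω i)) := continuous_fourier (hω.integrable i)
  have h := (hω.integrable i).fourierInv_fourier_eq hint
    (hω.contDiff_ofReal i).continuous.continuousAt (v := 0)
  rw [Real.fourierInv_eq] at h
  simp only [inner_zero_right, AddChar.map_zero_eq_one, one_smul] at h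
  have h2 : ∫ ξ, (fourierHat (ω i) ξ).re = ω i 0 := by
    have := congrArg Complex.re h
    rw [Complex.ofReal_re] at this
    rw [← this]
    exact (integral_re hint)
  rw [← h2]
  refine MeasureTheory.integral_pos_of_integrable_nonneg_nonzero (x := 0)
    (Complex.continuous_re.comp hcont) hint.re
    (fun ξ => (Complex.le_def.mp (hω.fourierHat_nonneg i ξ)).1) ?_
  exact (Complex.lt_def.mp (hω.fourierHat_zero_pos i)).1.ne'

theorem IsWeight.exists_norm_fourierHat_le {k : ℕ} {ω : Fin k → ℝ → ℝ} (hω : IsWeight 3 ω) :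
    ∃ C : ℝ, 0 < C ∧ ∀ i ξ, ‖fourierHat (ω i) ξ‖ ≤ C / (1 + |ξ|) ^ 3 := by
  choose C hC h using fun i =>
    exists_norm_fourier_le (hω.contDiff_ofReal i) (hω.hasCompactSupport_ofReal i)
  refine ⟨∑ i, C i + 1, add_pos_of_nonneg_of_pos (Finset.sum_nonneg fun i _ => (hC i).le) one_pos,
    fun i ξ => (h i ξ).trans ?_⟩
  gcongr
  have := Finset.single_le_sum (fun i _ => (hC i).le) (Finset.mem_univ i)
  linarith

/-! ### Poisson summation on the line -/

theorem fourier_comp_div (f : ℝ → ℂ) {ρ : ℝ} (hρ : 0 < ρ) (ξ : ℝ) :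
    𝓕 (fun x => f (x / ρ)) ξ = ρ * 𝓕 f (ρ * ξ) := by
  rw [Real.fourier_real_eq_integral_exp_smul, Real.fourier_real_eq_integral_exp_smul]
  have := MeasureTheory.Measure.integral_comp_div
    (fun x : ℝ => Complex.exp (↑(-2 * Real.pi * x * (ρ * ξ)) * Complex.I) • f x) ρ
  rw [abs_of_pos hρ, Complex.real_smul] at this
  rw [← this]
  refine MeasureTheory.integral_congr_ae (Filter.Eventually.of_forall fun x => ?_)
  simp only
  congr 4
  field_simp

theorem summable_one_add_abs_int_inv_sq : Summable fun n : ℤ => ((1 + |(n : ℝ)|) ^ 2)⁻¹ := by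
  have h := (Real.summable_abs_int_rpow (b := 2) (by norm_num))
  refine Summable.of_norm_bounded_eventually (g := fun n : ℤ => |(n : ℝ)| ^ (-2 : ℝ)) h ?_
  filter_upwards [(Set.finite_singleton (0 : ℤ)).compl_mem_cofinite] with n hn
  have hn0 : (n : ℝ) ≠ 0 := by exact_mod_cast hn
  have : 0 < |(n : ℝ)| := abs_pos.mpr hn0
  rw [Real.norm_of_nonneg (by positivity), Real.rpow_neg this.le]
  norm_cast
  have h2 : 0 < |(n : ℝ)| ^ 2 := by positivity
  have h1 : |(n : ℝ)| ^ 2 ≤ (1 + |(n : ℝ)|) ^ 2 := by gcongr; linarith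
  exact_mod_cast inv_anti₀ h2 h1

theorem summable_norm_fourier_int {f : ℝ → ℂ} {C : ℝ}
    (h : ∀ ξ, ‖𝓕 f ξ‖ ≤ C / (1 + |ξ|) ^ 3) {ρ : ℝ} (hρ : 0 < ρ) :
    Summable fun b : ℤ => ‖𝓕 f (ρ * b)‖ := by
  have hC : 0 ≤ C := by
    have := (norm_nonneg _).trans (h 0)
    simpa using this
  refine Summable.of_nonneg_of_le (fun _ => norm_nonneg _) (fun b => ?_)
    (summable_one_add_abs_int_inv_sq.mul_left (C / (min 1 ρ) ^ 3))
  have hm : 0 < min 1 ρ := by positivity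
  refine (h _).trans ?_
  rw [div_mul_eq_mul_div, ← div_eq_mul_inv, div_div]
  have h1 : min 1 ρ * (1 + |(b : ℝ)|) ≤ 1 + |ρ * b| := by
    rw [abs_mul, abs_of_pos hρ, mul_add, mul_one]
    gcongr
    · exact min_le_left _ _
    · exact min_le_right _ _
  gcongr
  calc (1 + |(b : ℝ)|) ^ 2 * min 1 ρ ^ 3 ≤ (1 + |(b : ℝ)|) ^ 3 * min 1 ρ ^ 3 := by
        gcongr
        · linarith [abs_nonneg (b : ℝ)]
        · norm_num
    _ = (min 1 ρ * (1 + |(b : ℝ)|)) ^ 3 := by ring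
    _ ≤ _ := by gcongr

/-- Poisson summation for a compactly supported `C³` function on a shifted and scaled lattice. -/
theorem tsum_comp_div_eq {f : ℝ → ℂ} (hf : ContDiff ℝ 3 f) (hs : HasCompactSupport f)
    {ρ : ℝ} (hρ : 0 < ρ) (x : ℝ) :
    ∑' a : ℤ, f ((x + a) / ρ) =
      ∑' b : ℤ, ρ * 𝓕 f (ρ * b) * Complex.exp (2 * Real.pi * Complex.I * b * x) := by
  obtain ⟨C, hC, h⟩ := exists_norm_fourier_le hf hs
  have hcs : HasCompactSupport fun y : ℝ => f (y / ρ) := by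
    have := hs.comp_homeomorph (Homeomorph.mulRight₀ ρ⁻¹ (inv_ne_zero hρ.ne'))
    exact this
  have hp := Real.tsum_eq_tsum_fourier_of_rpow_decay_of_summable (f := fun y => f (y / ρ))
    (hf.continuous.comp (continuous_id.div_const ρ)) (b := 2) (by norm_num)
    (by
      refine Filter.EventuallyEq.trans_isBigO (f₂ := fun _ => (0 : ℂ)) ?_ (Asymptotics.isBigO_zero _ _)
      exact hasCompactSupport_iff_eventuallyEq.mp hcs |>.filter_mono
        (by rw [Filter.coclosedCompact_eq_cocompact]))
    (by
      simp_rw [fourier_comp_div f hρ]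
      exact ((summable_norm_fourier_int h hρ).of_norm).mul_left _) x
  refine hp.trans (tsum_congr fun b => ?_)
  rw [fourier_comp_div f hρ, fourier_coe_apply]
  simp

/-! ### Existence of a weight -/

-- Take `f ⋆ f` for an even real bump `f` supported in `[-1, 1]`: evenness makes `f̂` real, so the
-- transform `f̂ ^ 2` is non-negative, and at `0` it is `(∫ f) ^ 2 > 0`.
open MeasureTheory Convolution in
theorem exists_isWeight (k : ℕ) : ∃ ω : Fin k → ℝ → ℝ, IsWeight 3 ω := by
  let φ : ContDiffBump (0 : ℝ) := ⟨1 / 2, 1, by norm_num, by norm_num⟩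
  let f : ℝ → ℝ := φ
  have hfc : ContDiff ℝ 3 f := φ.contDiff
  have hfs : HasCompactSupport f := φ.hasCompactSupport
  have hfi : Integrable f := hfc.continuous.integrable_of_hasCompactSupport hfs
  let g : ℝ → ℂ := fun x => (f x : ℂ)
  have hgi : Integrable g := hfi.ofReal
  let w : ℝ → ℝ := f ⋆[ContinuousLinearMap.mul ℝ ℝ] f
  have hwg : (fun x => (w x : ℂ)) = g ⋆[ContinuousLinearMap.mul ℂ ℂ] g := by
    ext x
    simp only [w, g, convolution_def, ContinuousLinearMap.mul_apply']
    rw [← integral_complex_ofReal]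
    simp
  have hconj : ∀ ξ, starRingEnd ℂ (𝓕 g ξ) = 𝓕 g ξ := by
    intro ξ
    rw [Real.fourier_real_eq_integral_exp_smul, ← integral_conj, ← integral_neg_eq_self]
    refine integral_congr_ae (Filter.Eventually.of_forall fun x => ?_)
    have hx : f (-x) = f x := φ.neg x
    simp only [g, smul_eq_mul, map_mul, Complex.conj_ofReal, hx, ← Complex.exp_conj, Complex.conj_I]
    congr 2
    push_cast
    ring
  have hhat : ∀ ξ, fourierHat w ξ = (((𝓕 g ξ).re ^ 2 : ℝ) : ℂ) := by
    intro ξ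
    rw [fourierHat, hwg, Real.fourier_mul_convolution_eq hgi hgi, Complex.ofReal_pow,
      Complex.conj_eq_iff_re.mp (hconj ξ), sq]
  refine ⟨fun _ => w, fun _ x => ?_, fun _ => ?_, fun _ => ?_, fun _ ξ => ?_, fun _ => ?_⟩
  · exact integral_nonneg fun y => mul_nonneg φ.nonneg φ.nonneg
  · refine closure_minimal ((support_convolution_subset _).trans ?_) isClosed_Icc
    rintro _ ⟨x, hx, y, hy, rfl⟩
    have hsup : Function.support f = Metric.ball 0 1 := φ.support_eq
    rw [hsup, mem_ball_zero_iff, Real.norm_eq_abs, abs_lt] at hx hy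
    constructor <;> simp only <;> linarith [hx.1, hx.2, hy.1, hy.2]
  · exact hfs.contDiff_convolution_left (n := 3) _ hfc hfi.locallyIntegrable
  · rw [hhat]
    exact_mod_cast sq_nonneg (𝓕 g ξ).re
  · rw [hhat]
    have h0 : 𝓕 g 0 = ((∫ x, f x : ℝ) : ℂ) := by
      rw [Real.fourier_real_eq_integral_exp_smul, ← integral_complex_ofReal]
      simp [g]
    have hpos : 0 < ∫ x, f x := φ.integral_pos
    rw [h0, Complex.ofReal_re]
    exact_mod_cast pow_pos hpos 2

/-! ### Small products force large discrepancy -/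

/-- The weighted count in a box only has finitely many non-zero summands. -/
theorem IsWeight.finite_support {d : ℕ} {ω : Fin (d + 1) → ℝ → ℝ} (hω : IsWeight 3 ω)
    (α : Fin d → ℝ) (B : Box d) {N : ℕ} (hN : 1 ≤ N) :
    (Function.support fun a : Fin (d + 1) → ℤ => ω (Fin.last d) ((a (Fin.last d) : ℝ) / N) *
      ∏ i : Fin d, ω i.castSucc
        (((a i.castSucc : ℝ) + (a (Fin.last d) : ℝ) * α i - B.γ i) / B.ρ i)).Finite := by
  have hN0 : (0 : ℝ) < N := by exact_mod_cast hN
  let R : Fin (d + 1) → ℤ :=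
    Fin.snoc (fun i : Fin d => ⌈2 * B.ρ i + 2 * N * |α i| + |B.γ i|⌉) (2 * N : ℤ)
  refine (Set.finite_Icc (-R) R).subset fun a ha => ?_
  rw [Function.mem_support, mul_ne_zero_iff, Finset.prod_ne_zero_iff] at ha
  obtain ⟨h1, h2⟩ := ha
  have hlast : |(a (Fin.last d) : ℝ)| ≤ 2 * N := by
    by_contra! h
    refine h1 (hω.eq_zero_of_lt _ ?_)
    rwa [abs_div, abs_of_pos hN0, lt_div_iff₀ hN0]
  have habs : ∀ i, |a i| ≤ R i := by
    intro i
    induction i using Fin.lastCases with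
    | last =>
      simp only [R, Fin.snoc_last]
      exact_mod_cast hlast
    | cast i =>
      simp only [R, Fin.snoc_castSucc]
      have hρ := (B.ρ_mem i).1
      have h3 : |(a i.castSucc : ℝ) + a (Fin.last d) * α i - B.γ i| ≤ 2 * B.ρ i := by
        by_contra! h
        refine h2 i (Finset.mem_univ _) (hω.eq_zero_of_lt _ ?_)
        rwa [abs_div, abs_of_pos hρ, lt_div_iff₀ hρ]
      have h4 : |(a i.castSucc : ℝ)| ≤ 2 * B.ρ i + 2 * N * |α i| + |B.γ i| := by
        have e : (a i.castSucc : ℝ) = (a i.castSucc + a (Fin.last d) * α i - B.γ i)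
            - a (Fin.last d) * α i + B.γ i := by ring
        rw [e]
        refine (abs_add_le _ _).trans ?_
        gcongr
        refine (abs_sub _ _).trans ?_
        rw [abs_mul (a (Fin.last d) : ℝ)]
        gcongr
      have := h4.trans (Int.le_ceil _)
      exact_mod_cast this
  exact ⟨fun i => (abs_le.mp (habs i)).1, fun i => (abs_le.mp (habs i)).2⟩

theorem IsWeight.exists_uniform_lower_bound {k : ℕ} {ω : Fin k → ℝ → ℝ} (hω : IsWeight 3 ω) :
    ∃ r > 0, ∃ c > 0, ∀ i x, |x| ≤ r → c ≤ ω i x := by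
  have h : ∀ᶠ x in nhds (0 : ℝ), ∀ i, ω i 0 / 2 < ω i x := by
    rw [Filter.eventually_all]
    intro i
    exact (hω.contDiff i).continuous.continuousAt.eventually_const_lt
      (half_lt_self (hω.apply_zero_pos i))
  obtain ⟨r, hr, h⟩ := Metric.eventually_nhds_iff.mp h
  obtain ⟨c, hc, hc'⟩ : ∃ c > 0, ∀ i, c ≤ ω i 0 / 2 := by
    rcases isEmpty_or_nonempty (Fin k) with he | he
    · exact ⟨1, one_pos, fun i => he.elim i⟩
    · obtain ⟨i₀, hi₀⟩ := Finite.exists_min fun i => ω i 0 / 2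
      exact ⟨_, half_pos (hω.apply_zero_pos i₀), hi₀⟩
  refine ⟨r / 2, by linarith, c, hc, fun i x hx => (hc' i).trans (h ?_ i).le⟩
  rw [Real.dist_eq, sub_zero]
  linarith

/-- The multiples of a good denominator lie in a small box around the origin. -/
theorem IsWeight.le_count {d : ℕ} {ω : Fin (d + 1) → ℝ → ℝ} (hω : IsWeight 3 ω) {r c : ℝ}
    (hr : 0 < r) (hc : 0 < c) (hrc : ∀ i x, |x| ≤ r → c ≤ ω i x)
    (α : Fin d → ℝ) (B : Box d) (hγ : B.γ = 0) {K h : ℕ} (hK : 1 ≤ K) (hh : 1 ≤ h)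
    (hB : ∀ i, K * distInt (h * α i) ≤ B.ρ i) :
    r * K * c ^ (d + 1) ≤
      ∑' a : Fin (d + 1) → ℤ, ω (Fin.last d) ((a (Fin.last d) : ℝ) / (K * h : ℕ)) *
        ∏ i : Fin d, ω i.castSucc
          (((a i.castSucc : ℝ) + (a (Fin.last d) : ℝ) * α i - B.γ i) / B.ρ i) := by
  have hK0 : (0 : ℝ) < K := by exact_mod_cast hK
  have hh0 : (0 : ℝ) < h := by exact_mod_cast hh
  -- The lattice point of the index `j * h`. For `j ≤ r * K` all arguments of the weights are at
  -- most `r` in absolute value.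
  let e : ℕ → Fin (d + 1) → ℤ := fun j =>
    Fin.snoc (fun i : Fin d => -(j * round (h * α i)) : Fin d → ℤ) (j * h : ℤ)
  have he : Function.Injective e := by
    intro j j' hj
    have := congrFun hj (Fin.last d)
    simp only [e, Fin.snoc_last] at this
    have h2 : (h : ℤ) ≠ 0 := by exact_mod_cast (by omega : h ≠ 0)
    exact_mod_cast mul_right_cancel₀ h2 this
  have hs := summable_of_hasFiniteSupport (L := SummationFilter.unconditional _)
    (hω.finite_support α B (N := K * h) (Nat.mul_pos hK hh))
  have hterm : ∀ j ∈ Finset.range (⌊r * K⌋₊ + 1), c ^ (d + 1) ≤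
      ω (Fin.last d) ((e j (Fin.last d) : ℝ) / (K * h : ℕ)) * ∏ i : Fin d, ω i.castSucc
          (((e j i.castSucc : ℝ) + (e j (Fin.last d) : ℝ) * α i - B.γ i) / B.ρ i) := by
    intro j hj
    have hj : (j : ℝ) ≤ r * K := by
      refine le_trans ?_ (Nat.floor_le (by positivity))
      exact_mod_cast Nat.lt_succ_iff.mp (Finset.mem_range.mp hj)
    rw [pow_succ']
    refine mul_le_mul (hrc _ _ ?_) ?_ (by positivity) (hω.nonneg _ _)
    · simp only [e, Fin.snoc_last]
      push_cast
      rw [mul_div_mul_right _ _ hh0.ne', abs_of_nonneg (by positivity), div_le_iff₀ hK0]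
      exact hj
    · rw [← Fin.prod_const]
      refine Finset.prod_le_prod (fun _ _ => hc.le) fun i _ => hrc _ _ ?_
      have hρ := (B.ρ_mem i).1
      simp only [e, Fin.snoc_last, Fin.snoc_castSucc, hγ, Pi.zero_apply]
      rw [abs_div, abs_of_pos hρ, div_le_iff₀ hρ]
      push_cast
      have : -((j : ℝ) * round (h * α i)) + j * h * α i - 0 = j * (h * α i - round (h * α i)) := by
        ring
      rw [this, abs_mul, Nat.abs_cast]
      calc (j : ℝ) * |h * α i - round (h * α i)| ≤ r * K * distInt (h * α i) := by
            rw [distInt]; gcongr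
        _ = r * (K * distInt (h * α i)) := by ring
        _ ≤ _ := by gcongr; exact hB i
  calc r * K * c ^ (d + 1) ≤ ∑ j ∈ Finset.range (⌊r * K⌋₊ + 1), c ^ (d + 1) := by
        rw [Finset.sum_const, Finset.card_range, nsmul_eq_mul]
        gcongr
        push_cast
        exact (Nat.lt_floor_add_one _).le
    _ ≤ _ := Finset.sum_le_sum hterm
    _ = _ := (Finset.sum_image (s := Finset.range (⌊r * K⌋₊ + 1)) (g := e)
        (f := fun a => ω (Fin.last d) ((a (Fin.last d) : ℝ) / (K * h : ℕ)) *
          ∏ i : Fin d, ω i.castSucc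
            (((a i.castSucc : ℝ) + (a (Fin.last d) : ℝ) * α i - B.γ i) / B.ρ i))
        he.injOn).symm
    _ ≤ _ := hs.sum_le_tsum _ fun a _ =>
        mul_nonneg (hω.nonneg _ _) (Finset.prod_nonneg fun _ _ => hω.nonneg _ _)

/-- If `n ∏ ‖n αᵢ‖` takes arbitrarily small values, this happens with all `‖n αᵢ‖` small. -/
theorem exists_mul_prod_distInt_lt {d : ℕ} {α : Fin d → ℝ}
    (hα : ∀ ε > 0, ∃ n : ℕ, 1 ≤ n ∧ n * ∏ i, distInt (n * α i) < ε) {M : ℕ} (hM : 1 ≤ M)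
    {ε : ℝ} (hε : 0 < ε) :
    ∃ h : ℕ, 1 ≤ h ∧ (∀ i, distInt (h * α i) < 1 / M) ∧ h * ∏ i, distInt (h * α i) < ε := by
  have hM0 : (0 : ℝ) < M := by exact_mod_cast hM
  -- Dirichlet applied to `n * α` gives a multiplier `q ≤ M ^ d`. Passing from `n` to `q * n` costs
  -- a factor at most `q ^ (d + 1)`.
  obtain ⟨n, hn, hn'⟩ := hα (ε / ((M : ℝ) ^ d) ^ (d + 1)) (by positivity)
  obtain ⟨q, hq, hqM, a, ha⟩ := exists_simultaneous_approx (fun i => n * α i) (fun _ => M)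
    fun _ => hM
  rw [Fin.prod_const] at hqM
  have hqM' : (q : ℝ) ≤ (M : ℝ) ^ d := by exact_mod_cast hqM
  refine ⟨q * n, Nat.mul_pos hq hn, fun i => ?_, ?_⟩
  · push_cast
    rw [mul_assoc]
    exact (distInt_le _ (a i)).trans_lt (ha i)
  · rw [lt_div_iff₀ (by positivity)] at hn'
    refine lt_of_le_of_lt ?_ hn'
    calc ((q * n : ℕ) : ℝ) * ∏ i, distInt ((q * n : ℕ) * α i)
        ≤ (q * n) * ∏ i, (q * distInt (n * α i)) := by
          push_cast
          gcongr with i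
          · exact fun i _ => distInt_nonneg _
          · rw [mul_assoc]; exact distInt_nat_mul_le _ _
      _ = n * (∏ i, distInt (n * α i)) * q ^ (d + 1) := by
          rw [Finset.prod_mul_distrib, Fin.prod_const]; ring
      _ ≤ _ := by
          have : 0 ≤ ∏ i, distInt (n * α i) := Finset.prod_nonneg fun i _ => distInt_nonneg _
          gcongr

theorem hasUnboundedDiscrepancy_of_small_values {d : ℕ} {ω : Fin (d + 1) → ℝ → ℝ}
    (hω : IsWeight 3 ω) {α : Fin d → ℝ}
    (hα : ∀ ε > 0, ∃ n : ℕ, 1 ≤ n ∧ n * ∏ i, distInt (n * α i) < ε) :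
    HasUnboundedDiscrepancy ω α := by
  intro C
  obtain ⟨r, hr, c, hc, hrc⟩ := hω.exists_uniform_lower_bound
  obtain ⟨K, hK⟩ := exists_nat_gt (max 1 ((C + 1) / (r * c ^ (d + 1))))
  have hK1 : (1 : ℝ) < K := (le_max_left _ _).trans_lt hK
  have hK2 := (le_max_right _ _).trans_lt hK
  rw [div_lt_iff₀ (by positivity)] at hK2
  have hKn : 1 ≤ K := by exact_mod_cast hK1.le
  set E := |expectWeight ω|
  have hE : 0 ≤ E := abs_nonneg _
  -- `M = 4 * K` gives `K * ‖h αᵢ‖ < 1 / 4`, leaving room for `η ≤ 1 / 4` below the limit `1 / 2` on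
  -- the radii.
  obtain ⟨h, hh, hsmall, hprod⟩ := exists_mul_prod_distInt_lt hα (M := 4 * K) (by omega)
    (ε := 1 / ((E + 1) * K ^ (d + 1))) (by positivity)
  -- Some `‖h αᵢ‖` may be zero, whereas radii must be positive; continuity allows enlarging all of
  -- them by a small `η`.
  have hlim : ∀ᶠ η in nhds (0 : ℝ),
      (E + 1) * ((∏ i, (K * distInt (h * α i) + η)) * (K * h : ℕ)) < 1 := by
    have hcont : Continuous fun η : ℝ =>
      (E + 1) * ((∏ i, (K * distInt (h * α i) + η)) * (K * h : ℕ)) := by fun_prop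
    refine hcont.continuousAt.eventually_lt_const ?_
    simp only [add_zero, Finset.prod_mul_distrib, Fin.prod_const]
    rw [lt_div_iff₀ (by positivity)] at hprod
    push_cast
    calc _ = h * (∏ i, distInt (h * α i)) * ((E + 1) * K ^ (d + 1)) := by ring
      _ < 1 := hprod
  obtain ⟨δ, hδ, hlim⟩ := Metric.eventually_nhds_iff.mp hlim
  set η := min (δ / 2) (1 / 4)
  have hη : 0 < η := by positivity
  have hη1 : η ≤ 1 / 4 := min_le_right _ _
  have hvol := hlim (y := η) (by
    rw [Real.dist_eq, sub_zero, abs_of_pos hη]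
    exact (min_le_left _ _).trans_lt (half_lt_self hδ))
  let B : Box d := ⟨0, fun i => K * distInt (h * α i) + η, fun i => by
    refine ⟨by have := distInt_nonneg (h * α i); positivity, ?_⟩
    have := hsmall i
    push_cast at this
    rw [lt_div_iff₀ (by positivity)] at this
    linarith⟩
  refine ⟨K * h, Nat.mul_pos hKn hh, ?_⟩
  refine lt_of_lt_of_le ?_ (le_iSup _ B)
  rw [EReal.coe_lt_coe_iff]
  refine lt_of_lt_of_le ?_ (le_abs_self _)
  have hcount := hω.le_count hr hc hrc α B rfl hKn hh fun i => by simp [B, hη.le]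
  have hexp : expectWeight ω * B.vol (K * h) ≤ 1 := by
    refine le_trans ?_ hvol.le
    have hv : 0 ≤ B.vol (K * h) :=
      mul_nonneg (Finset.prod_nonneg fun i _ => (B.ρ_mem i).1.le) (Nat.cast_nonneg _)
    exact mul_le_mul_of_nonneg_right ((le_abs_self _).trans (by linarith)) hv
  rw [boxDiscrepancy]
  linarith

/-! ### From the lower limit to bounds for all `n` -/

theorem LittlewoodConjecture.exists_lt {d : ℕ} (h : LittlewoodConjecture d) (α : Fin d → ℝ) :
    ∀ ε > 0, ∃ n : ℕ, 1 ≤ n ∧ n * ∏ i, distInt (n * α i) < ε := by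
  intro ε hε
  have hf := Filter.frequently_lt_of_liminf_lt (b := (ε : EReal)) (by isBoundedDefault)
    (by rw [h α]; exact_mod_cast hε)
  obtain ⟨n, hn, hn'⟩ := (hf.and_eventually (Filter.eventually_ge_atTop 1)).exists
  exact ⟨n, hn', by exact_mod_cast hn⟩

/-- A positive lower limit controls large `n`. The finitely many others are harmless unless a
product vanishes, but then it would vanish at all multiples of `n`, including large ones. -/
theorem exists_lower_bound_of_liminf_ne {d : ℕ} (α : Fin d → ℝ)
    (h : Filter.liminf (fun n : ℕ => (((n : ℝ) * ∏ i, distInt ((n : ℝ) * α i) : ℝ) : EReal))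
      Filter.atTop ≠ 0) :
    ∃ c > 0, ∀ n : ℕ, 0 < n → ∀ a : Fin d → ℤ, c ≤ n * ∏ i, |n * α i - a i| := by
  have hnn : ∀ n : ℕ, 0 ≤ (n : ℝ) * ∏ i, distInt (n * α i) := fun n =>
    mul_nonneg (Nat.cast_nonneg _) (Finset.prod_nonneg fun _ _ => distInt_nonneg _)
  have h0 : 0 < Filter.liminf
      (fun n : ℕ => (((n : ℝ) * ∏ i, distInt ((n : ℝ) * α i) : ℝ) : EReal)) Filter.atTop := by
    refine lt_of_le_of_ne (Filter.le_liminf_of_le (by isBoundedDefault) ?_) h.symm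
    exact Filter.Eventually.of_forall fun n => by exact_mod_cast hnn n
  obtain ⟨c, hc0, hc⟩ := EReal.lt_iff_exists_real_btwn.mp h0
  have hev := Filter.eventually_lt_of_lt_liminf hc
  obtain ⟨n₀, hn₀⟩ := Filter.eventually_atTop.mp hev
  have hc0 : 0 < c := by exact_mod_cast hc0
  have hn₀ : ∀ n ≥ n₀, c < n * ∏ i, distInt (n * α i) := fun n hn => by exact_mod_cast hn₀ n hn
  have hpos : ∀ n : ℕ, 0 < n → 0 < n * ∏ i, distInt (n * α i) := by
    intro n hn
    have hn0 : (0 : ℝ) < n := by exact_mod_cast hn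
    refine mul_pos hn0 (Finset.prod_pos fun i _ => ?_)
    refine (distInt_nonneg _).lt_of_ne' fun hz => ?_
    have h1 := hn₀ ((n₀ + 1) * n) (by nlinarith)
    have h2 : distInt (((n₀ + 1) * n : ℕ) * α i) = 0 := by
      refine le_antisymm ?_ (distInt_nonneg _)
      have := distInt_nat_mul_le (n₀ + 1) (n * α i)
      rw [hz, mul_zero] at this
      push_cast at this ⊢
      rwa [mul_assoc]
    rw [Finset.prod_eq_zero (Finset.mem_univ i) h2, mul_zero] at h1
    linarith
  obtain ⟨c', hc', hlow⟩ : ∃ c' > 0, ∀ n ∈ Finset.Icc 1 (n₀ + 1),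
      c' ≤ n * ∏ i, distInt (n * α i) := by
    obtain ⟨m, hm, hmin⟩ := Finset.exists_min_image (Finset.Icc 1 (n₀ + 1))
      (fun n : ℕ => (n : ℝ) * ∏ i, distInt (n * α i)) ⟨1, by simp⟩
    exact ⟨_, hpos m (Finset.mem_Icc.mp hm).1, hmin⟩
  refine ⟨min c c', by positivity, fun n hn a => ?_⟩
  have h1 : min c c' ≤ n * ∏ i, distInt (n * α i) := by
    rcases le_total n₀ n with hle | hle
    · exact (min_le_left _ _).trans (hn₀ n hle).le
    · exact (min_le_right _ _).trans (hlow n (Finset.mem_Icc.mpr ⟨hn, by omega⟩))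
  refine h1.trans ?_
  gcongr with i
  · exact fun i _ => distInt_nonneg _
  · exact distInt_le _ _

/-! ### Sums over the rescaled dual lattice -/

theorem summable_norm_prod_and_tsum_prod {𝕜 : Type*} [NormedField 𝕜] [CompleteSpace 𝕜]
    {β : Type*} {d : ℕ} (f : Fin d → β → 𝕜) (hf : ∀ i, Summable fun b => ‖f i b‖) :
    (Summable fun b : Fin d → β => ‖∏ i, f i (b i)‖) ∧
      ∑' b : Fin d → β, ∏ i, f i (b i) = ∏ i, ∑' n, f i n := by
  induction d with
  | zero =>
    exact ⟨(hasSum_fintype _).summable, by simp⟩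
  | succ d ih =>
    obtain ⟨h1, h2⟩ := ih (fun i => f i.succ) fun i => hf _
    let F : (Fin d → β) → 𝕜 := fun b => ∏ i, f i.succ (b i)
    let e : β × (Fin d → β) ≃ (Fin (d + 1) → β) := Fin.consEquiv fun _ => β
    have hcomp : ∀ p : β × (Fin d → β), ∏ i, f i (e p i) = f 0 p.1 * F p.2 := by
      intro p
      rw [Fin.prod_univ_succ]
      rfl
    have hF : Summable fun b => ‖F b‖ := h1
    have hf0 : Summable fun b => ‖f 0 b‖ := hf 0
    have hmul : Summable fun p : β × (Fin d → β) => ‖f 0 p.1 * F p.2‖ := hf0.mul_norm hF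
    constructor
    · refine (hmul.comp_injective e.symm.injective).congr fun b => ?_
      rw [Function.comp_apply, ← hcomp, Equiv.apply_symm_apply]
    · rw [← e.tsum_eq, tsum_congr hcomp, Fin.prod_univ_succ, ← h2]
      exact (tsum_mul_tsum_of_summable_norm hf0 hF).symm

/-- The weight of a dual lattice point after rescaling by a box. -/
noncomputable def dualWeight {d : ℕ} (α ρ : Fin d → ℝ) (N : ℝ) (p : (Fin d → ℤ) × ℤ) : ℝ :=
  (∏ i, (1 + |ρ i * p.1 i|)) * (1 + |N * (p.2 - ∑ i, p.1 i * α i)|)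

theorem one_le_dualWeight {d : ℕ} (α ρ : Fin d → ℝ) (N : ℝ) (p : (Fin d → ℤ) × ℤ) :
    1 ≤ dualWeight α ρ N p :=
  one_le_mul_of_one_le_of_one_le
    (Finset.prod_induction _ (1 ≤ ·) (fun _ _ => one_le_mul_of_one_le_of_one_le) le_rfl
      fun i _ => by linarith [abs_nonneg (ρ i * p.1 i)])
    (by linarith [abs_nonneg (N * (p.2 - ∑ i, p.1 i * α i))])

section Dual

variable {d : ℕ} {α ρ : Fin d → ℝ} {N c : ℝ}

/-- Sharper than a bound by `dualWeight`: no `1` is added to the linear form, so for a difference of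
two points in one cell the form itself must be large. -/
theorem le_mul_prod_max
    (hα : ∀ (b : Fin d → ℤ) (m : ℤ), (b ≠ 0 ∨ m ≠ 0) →
      c ≤ |m - ∑ i, b i * α i| * ∏ i, max 1 |(b i : ℝ)|)
    (hρ : ∀ i, ρ i ∈ Set.Ioo (0 : ℝ) (1 / 2)) (hN : 0 < N) {p : (Fin d → ℤ) × ℤ} (hp : p ≠ 0) :
    c * ((∏ i, ρ i) * N) ≤
      (∏ i, max (ρ i) |ρ i * p.1 i|) * |N * (p.2 - ∑ i, p.1 i * α i)| := by
  have hp' : p.1 ≠ 0 ∨ p.2 ≠ 0 := by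
    by_contra! h
    exact hp (Prod.ext h.1 h.2)
  have hprod : 0 < ∏ i, ρ i := Finset.prod_pos fun i _ => (hρ i).1
  have e : ∀ i, max (ρ i) |ρ i * p.1 i| = ρ i * max 1 |(p.1 i : ℝ)| := by
    intro i
    rw [abs_mul, abs_of_pos (hρ i).1, mul_max_of_nonneg _ _ (hρ i).1.le, mul_one]
  simp_rw [e]
  rw [Finset.prod_mul_distrib, abs_mul, abs_of_pos hN]
  calc _ ≤ (|p.2 - ∑ i, p.1 i * α i| * ∏ i, max 1 |(p.1 i : ℝ)|) * ((∏ i, ρ i) * N) := by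
        gcongr
        exact hα _ _ hp'
    _ = _ := by ring

theorem le_dualWeight
    (hα : ∀ (b : Fin d → ℤ) (m : ℤ), (b ≠ 0 ∨ m ≠ 0) →
      c ≤ |m - ∑ i, b i * α i| * ∏ i, max 1 |(b i : ℝ)|)
    (hρ : ∀ i, ρ i ∈ Set.Ioo (0 : ℝ) (1 / 2)) (hN : 0 < N) {p : (Fin d → ℤ) × ℤ} (hp : p ≠ 0) :
    c * ((∏ i, ρ i) * N) ≤ dualWeight α ρ N p := by
  refine (le_mul_prod_max hα hρ hN hp).trans ?_
  rw [dualWeight]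
  refine mul_le_mul (Finset.prod_le_prod
      (fun i _ => (abs_nonneg (ρ i * p.1 i)).trans (le_max_right _ _)) fun i _ => ?_)
    (le_add_of_nonneg_left zero_le_one) (abs_nonneg _)
    (Finset.prod_nonneg fun _ _ => by positivity)
  exact max_le (by linarith [(hρ i).2, abs_nonneg (ρ i * p.1 i)]) (by linarith)

/-- The integer cell of a rescaled dual lattice point, the last coordinate being split further
into `J` parts. -/
noncomputable def dualCell (α ρ : Fin d → ℝ) (N : ℝ) (J : ℕ) (p : (Fin d → ℤ) × ℤ) :
    (Fin d → ℤ) × ℤ × Fin (J + 1) :=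
  (fun i => ⌊ρ i * p.1 i⌋, ⌊N * (p.2 - ∑ i, p.1 i * α i)⌋,
    ⟨⌊Int.fract (N * (p.2 - ∑ i, p.1 i * α i)) * (J + 1 : ℕ)⌋₊, by
      rw [Nat.floor_lt (mul_nonneg (Int.fract_nonneg _) (Nat.cast_nonneg _))]
      exact mul_lt_of_lt_one_left (by positivity) (Int.fract_lt_one _)⟩)

/-- Two points in one cell differ by a dual point with all `|ρᵢ bᵢ| < 1` and linear form below `1 /
(J + 1) ≤ c ρ₁ ⋯ ρ_d N`, which the dual bound permits only for zero. -/
theorem dualCell_injective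
    (hα : ∀ (b : Fin d → ℤ) (m : ℤ), (b ≠ 0 ∨ m ≠ 0) →
      c ≤ |m - ∑ i, b i * α i| * ∏ i, max 1 |(b i : ℝ)|)
    (hρ : ∀ i, ρ i ∈ Set.Ioo (0 : ℝ) (1 / 2)) (hN : 0 < N) {J : ℕ}
    (hJ : 1 ≤ (J + 1 : ℕ) * (c * ((∏ i, ρ i) * N))) : Function.Injective (dualCell α ρ N J) := by
  intro p q hpq
  by_contra hne
  have hlow := le_mul_prod_max hα hρ hN (sub_ne_zero.mpr hne)
  simp only [dualCell, Prod.mk.injEq, Fin.mk.injEq] at hpq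
  obtain ⟨h1, h2, h3⟩ := hpq
  have hJ0 : (0 : ℝ) < (J + 1 : ℕ) := by positivity
  set u := N * (p.2 - ∑ i, p.1 i * α i)
  set v := N * (q.2 - ∑ i, q.1 i * α i)
  have huv : N * (((p - q).2 : ℤ) - ∑ i, ((p - q).1 i : ℤ) * α i) = u - v := by
    simp only [u, v, Prod.snd_sub, Prod.fst_sub, Pi.sub_apply]
    push_cast
    simp only [sub_mul, Finset.sum_sub_distrib]
    ring
  have hlt : (J + 1 : ℕ) * |u - v| < 1 := by
    have a1 := Nat.floor_le (mul_nonneg (Int.fract_nonneg u) hJ0.le)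
    have a2 := Nat.lt_floor_add_one (Int.fract u * (J + 1 : ℕ))
    have a3 := Nat.floor_le (mul_nonneg (Int.fract_nonneg v) hJ0.le)
    have a4 := Nat.lt_floor_add_one (Int.fract v * (J + 1 : ℕ))
    rw [h3] at a1 a2
    have e : u - v = Int.fract u - Int.fract v := by
      rw [Int.fract, Int.fract, h2]; ring
    have habs : |(J + 1 : ℕ) * (u - v)| < 1 := by
      rw [abs_lt, e]
      constructor <;> nlinarith
    rwa [abs_mul, abs_of_pos hJ0] at habs
  have hprod : ∏ i, max (ρ i) |ρ i * ((p - q).1 i : ℤ)| ≤ 1 := by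
    refine Finset.prod_le_one (fun i _ => (abs_nonneg _).trans (le_max_right _ _)) fun i _ => ?_
    refine max_le (by linarith [(hρ i).2]) ?_
    have := Int.abs_sub_lt_one_of_floor_eq_floor (congrFun h1 i)
    rw [Prod.fst_sub, Pi.sub_apply]
    push_cast
    rw [mul_sub]
    exact this.le
  rw [huv] at hlow
  have : c * ((∏ i, ρ i) * N) ≤ |u - v| :=
    hlow.trans (mul_le_of_le_one_left (abs_nonneg _) hprod)
  nlinarith

theorem sq_inv_le_floor (x : ℝ) : ((1 + |x|) ^ 2)⁻¹ ≤ 4 * ((1 + |(⌊x⌋ : ℝ)|) ^ 2)⁻¹ := by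
  have h : |(⌊x⌋ : ℝ)| ≤ |x| + 1 := by
    have h1 := Int.floor_le x
    have h2 := Int.lt_floor_add_one x
    have h3 := le_abs_self x
    have h4 := neg_abs_le x
    rw [abs_le]
    constructor <;> linarith
  rw [← div_eq_mul_inv, inv_eq_one_div, div_le_div_iff₀ (by positivity) (by positivity)]
  calc 1 * (1 + |(⌊x⌋ : ℝ)|) ^ 2 ≤ (2 * (1 + |x|)) ^ 2 := by
        rw [one_mul]
        gcongr
        linarith [abs_nonneg x]
    _ = _ := by ring

/-- The sum over the rescaled dual lattice, by counting points in unit cells. -/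
theorem summable_dualWeight_and_tsum_le
    (hα : ∀ (b : Fin d → ℤ) (m : ℤ), (b ≠ 0 ∨ m ≠ 0) →
      c ≤ |m - ∑ i, b i * α i| * ∏ i, max 1 |(b i : ℝ)|)
    (hρ : ∀ i, ρ i ∈ Set.Ioo (0 : ℝ) (1 / 2)) (hN : 0 < N) {J : ℕ}
    (hJ : 1 ≤ (J + 1 : ℕ) * (c * ((∏ i, ρ i) * N))) :
    (Summable fun p => (dualWeight α ρ N p ^ 2)⁻¹) ∧
      ∑' p, (dualWeight α ρ N p ^ 2)⁻¹ ≤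
        (J + 1 : ℕ) * (∑' n : ℤ, 4 * ((1 + |(n : ℝ)|) ^ 2)⁻¹) ^ (d + 1) := by
  set g : ℤ → ℝ := fun n => 4 * ((1 + |(n : ℝ)|) ^ 2)⁻¹
  have hg0 : ∀ n, 0 ≤ g n := fun n => by positivity
  have hg : Summable fun n => ‖g n‖ := (summable_one_add_abs_int_inv_sq.mul_left 4).norm
  obtain ⟨h1, h2⟩ := summable_norm_prod_and_tsum_prod (fun _ : Fin d => g) fun _ => hg
  have hone : Summable fun _ : Fin (J + 1) => ‖(1 : ℝ)‖ := (hasSum_fintype _).summable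
  let G : (Fin d → ℤ) → ℝ := fun b => ∏ i, g (b i)
  let G' : ℤ × Fin (J + 1) → ℝ := fun y => g y.1 * (fun _ => (1 : ℝ)) y.2
  let H : (Fin d → ℤ) × ℤ × Fin (J + 1) → ℝ := fun z => G z.1 * G' z.2
  have hG : Summable fun b => ‖G b‖ := h1
  have hH0 : ∀ z, 0 ≤ H z := fun z =>
    mul_nonneg (Finset.prod_nonneg fun _ _ => hg0 _) (mul_nonneg (hg0 _) zero_le_one)
  have hG' : Summable fun y => ‖G' y‖ :=
    Summable.mul_norm (f := g) (g := fun _ : Fin (J + 1) => (1 : ℝ)) hg hone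
  have hH : Summable H := (Summable.mul_norm (f := G) (g := G') hG hG').of_norm
  have hGsum : ∑' b, G b = (∑' n, g n) ^ d := by rw [h2, Fin.prod_const]
  have hG'sum : ∑' y, G' y = (∑' n, g n) * (J + 1 : ℕ) := by
    refine (tsum_mul_tsum_of_summable_norm (f := g) (g := fun _ : Fin (J + 1) => (1 : ℝ))
      hg hone).symm.trans ?_
    simp
  have hHsum : ∑' z, H z = (J + 1 : ℕ) * (∑' n, g n) ^ (d + 1) := by
    refine (tsum_mul_tsum_of_summable_norm (f := G) (g := G') hG hG').symm.trans ?_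
    rw [hGsum, hG'sum]
    ring
  -- Each cell is used at most once, so the sum is dominated by that of `H` over all cells, which
  -- factors.
  have hinj := dualCell_injective hα hρ hN hJ
  have hle : ∀ p, (dualWeight α ρ N p ^ 2)⁻¹ ≤ H (dualCell α ρ N J p) := by
    intro p
    simp only [dualWeight, H, G, G', dualCell, mul_one, mul_pow, mul_inv, ← Finset.prod_pow,
      ← Finset.prod_inv_distrib]
    exact mul_le_mul (Finset.prod_le_prod (fun _ _ => by positivity) fun i _ => sq_inv_le_floor _)
      (sq_inv_le_floor _) (by positivity) (Finset.prod_nonneg fun _ _ => hg0 _)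
  have hs : Summable fun p => (dualWeight α ρ N p ^ 2)⁻¹ :=
    Summable.of_nonneg_of_le (fun p => by positivity) hle (hH.comp_injective hinj)
  refine ⟨hs, (hs.tsum_le_tsum hle (hH.comp_injective hinj)).trans ?_⟩
  rw [← hHsum]
  exact tsum_comp_le_tsum_of_inj hH hH0 hinj

end Dual

/-! ### Poisson summation for the count in a box -/

theorem fourier_mul_exp (f : ℝ → ℂ) (θ ξ : ℝ) :
    𝓕 (fun x : ℝ => f x * Complex.exp (2 * Real.pi * Complex.I * θ * x)) ξ = 𝓕 f (ξ - θ) := by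
  rw [Real.fourier_real_eq_integral_exp_smul, Real.fourier_real_eq_integral_exp_smul]
  refine MeasureTheory.integral_congr_ae (Filter.Eventually.of_forall fun x => ?_)
  simp only [smul_eq_mul]
  rw [mul_comm (f x), ← mul_assoc, ← Complex.exp_add]
  congr 2
  push_cast
  ring

theorem tsum_comp_div_mul_exp_eq {f : ℝ → ℂ} (hf : ContDiff ℝ 3 f) (hs : HasCompactSupport f)
    {N : ℝ} (hN : 0 < N) (β : ℝ) :
    ∑' n : ℤ, f (n / N) * Complex.exp (2 * Real.pi * Complex.I * (n * β)) =
      ∑' m : ℤ, N * 𝓕 f (N * (m - β)) := by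
  have hexp : ContDiff ℝ 3 fun x : ℝ =>
      Complex.exp (2 * Real.pi * Complex.I * (N * β : ℝ) * x) :=
    (contDiff_const.mul Complex.ofRealCLM.contDiff).cexp
  have h := tsum_comp_div_eq (hf.mul hexp) hs.mul_right hN 0
  refine Eq.trans (tsum_congr fun n => ?_) (h.trans (tsum_congr fun m => ?_))
  · simp only [zero_add]
    congr 2
    have : (N : ℂ) ≠ 0 := by exact_mod_cast hN.ne'
    push_cast
    field_simp
  · rw [fourier_mul_exp]
    simp [mul_sub]

/-- The summand of the dual side of Poisson summation for the weighted count in a box. -/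
noncomputable def dualTerm {d : ℕ} (ω : Fin (d + 1) → ℝ → ℝ) (α : Fin d → ℝ) (B : Box d) (N : ℕ)
    (p : (Fin d → ℤ) × ℤ) : ℂ :=
  (∏ i, B.ρ i * fourierHat (ω i.castSucc) (B.ρ i * p.1 i) *
      Complex.exp (2 * Real.pi * Complex.I * p.1 i * (-B.γ i : ℝ))) *
    (N * fourierHat (ω (Fin.last d)) (N * (p.2 - ∑ i, p.1 i * α i)))

theorem Box.vol_nonneg {d : ℕ} (B : Box d) (N : ℕ) : 0 ≤ B.vol N :=
  mul_nonneg (Finset.prod_nonneg fun i _ => (B.ρ_mem i).1.le) (Nat.cast_nonneg _)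

theorem norm_exp_two_pi_I_mul_int_mul (n : ℤ) (x : ℝ) :
    ‖Complex.exp (2 * Real.pi * Complex.I * n * x)‖ = 1 := by
  have : (2 * Real.pi * Complex.I * n * x : ℂ) = ((2 * Real.pi * n * x : ℝ) : ℂ) * Complex.I := by
    push_cast; ring
  rw [this, Complex.norm_exp_ofReal_mul_I]

/-- Of the three powers of `dualWeight`, two give convergence and the third gives the gain for large
boxes. -/
theorem norm_dualTerm_le {d : ℕ} {ω : Fin (d + 1) → ℝ → ℝ} {C : ℝ} (hC : 0 < C)
    (hω : ∀ i ξ, ‖fourierHat (ω i) ξ‖ ≤ C / (1 + |ξ|) ^ 3) (α : Fin d → ℝ) (B : Box d) (N : ℕ)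
    (p : (Fin d → ℤ) × ℤ) :
    ‖dualTerm ω α B N p‖ ≤ B.vol N * C ^ (d + 1) / dualWeight α B.ρ N p ^ 3 := by
  have h1 : ∀ i, ‖(B.ρ i : ℂ) * fourierHat (ω i.castSucc) (B.ρ i * p.1 i) *
      Complex.exp (2 * Real.pi * Complex.I * p.1 i * (-B.γ i : ℝ))‖ ≤
        B.ρ i * (C / (1 + |B.ρ i * p.1 i|) ^ 3) := by
    intro i
    rw [norm_mul, norm_mul, norm_exp_two_pi_I_mul_int_mul, mul_one, Complex.norm_real,
      Real.norm_of_nonneg (B.ρ_mem i).1.le]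
    exact mul_le_mul_of_nonneg_left (hω _ _) (B.ρ_mem i).1.le
  rw [dualTerm, norm_mul, norm_prod, norm_mul, Complex.norm_natCast]
  calc _ ≤ (∏ i, B.ρ i * (C / (1 + |B.ρ i * p.1 i|) ^ 3)) *
        (N * (C / (1 + |N * (p.2 - ∑ i, p.1 i * α i)|) ^ 3)) := by
        refine mul_le_mul (Finset.prod_le_prod (fun _ _ => norm_nonneg _) fun i _ => h1 i)
          (mul_le_mul_of_nonneg_left (hω _ _) (Nat.cast_nonneg _)) (by positivity)
          (Finset.prod_nonneg fun i _ => mul_nonneg (B.ρ_mem i).1.le (by positivity))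
    _ = _ := by
        rw [Finset.prod_mul_distrib, Finset.prod_div_distrib, Fin.prod_const, Finset.prod_pow,
          dualWeight, Box.vol]
        have : 0 < ∏ i, (1 + |B.ρ i * p.1 i|) := Finset.prod_pos fun i _ => by positivity
        field_simp
        ring

/-- Poisson summation for the weighted count in a box. -/
theorem IsWeight.tsum_count_eq {d : ℕ} {ω : Fin (d + 1) → ℝ → ℝ} (hω : IsWeight 3 ω)
    (α : Fin d → ℝ) (B : Box d) {N : ℕ} (hN : 1 ≤ N) (hsum : Summable (dualTerm ω α B N)) :
    ((∑' a : Fin (d + 1) → ℤ, ω (Fin.last d) ((a (Fin.last d) : ℝ) / N) *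
        ∏ i : Fin d, ω i.castSucc
          (((a i.castSucc : ℝ) + (a (Fin.last d) : ℝ) * α i - B.γ i) / B.ρ i) : ℝ) : ℂ) =
      ∑' p, dualTerm ω α B N p := by
  have hN0 : (0 : ℝ) < N := by exact_mod_cast hN
  obtain ⟨C, hC, hhat⟩ := hω.exists_norm_fourierHat_le
  let A : Fin d → ℤ → ℂ := fun i b => B.ρ i * fourierHat (ω i.castSucc) (B.ρ i * b) *
      Complex.exp (2 * Real.pi * Complex.I * b * (-B.γ i : ℝ))
  have hAexp : ∀ (n : ℤ) i b, ‖A i b * Complex.exp (2 * Real.pi * Complex.I * b * (n * α i : ℝ))‖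
      = ‖A i b‖ := fun n i b => by
    rw [norm_mul, norm_exp_two_pi_I_mul_int_mul, mul_one]
  have hA : ∀ i, Summable fun b => ‖A i b‖ := by
    intro i
    simp only [A, norm_mul, norm_exp_two_pi_I_mul_int_mul, mul_one]
    exact (summable_norm_fourier_int (hhat i.castSucc) (B.ρ_mem i).1).mul_left _
  obtain ⟨hAs, -⟩ := summable_norm_prod_and_tsum_prod A hA
  let e : ℤ × (Fin d → ℤ) ≃ (Fin (d + 1) → ℤ) := Fin.snocEquiv fun _ => ℤ
  have hs := (summable_of_hasFiniteSupport (L := SummationFilter.unconditional _)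
    (hω.finite_support α B hN)).comp_injective e.injective
  have hpoint : ∀ (n : ℤ) i (a : ℤ), (a + n * α i - B.γ i) / B.ρ i =
      ((n * α i - B.γ i) + a) / B.ρ i := fun n i a => by ring
  have hsup : ∀ (n : ℤ) i, (Function.support fun a : ℤ =>
      ω (Fin.castSucc i) (((n * α i - B.γ i) + a) / B.ρ i)).Finite := by
    intro n i
    have hρ := (B.ρ_mem i).1
    refine (Set.finite_Icc (-⌈2 * B.ρ i + |n * α i - B.γ i|⌉)
      ⌈2 * B.ρ i + |n * α i - B.γ i|⌉).subset fun a ha => ?_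
    have h3 : |(n * α i - B.γ i) + a| ≤ 2 * B.ρ i := by
      by_contra! h
      refine ha (hω.eq_zero_of_lt _ ?_)
      rwa [abs_div, abs_of_pos hρ, lt_div_iff₀ hρ]
    have h4 : |(a : ℝ)| ≤ 2 * B.ρ i + |n * α i - B.γ i| := by
      calc |(a : ℝ)| = |((n * α i - B.γ i) + a) - (n * α i - B.γ i)| := by ring_nf
        _ ≤ _ := (abs_sub _ _).trans (by gcongr)
    have h5 : |a| ≤ ⌈2 * B.ρ i + |n * α i - B.γ i|⌉ := by
      have := h4.trans (Int.le_ceil _)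
      exact_mod_cast this
    exact abs_le.mp h5
  -- For a fixed index `n`, Poisson summation in the first `d` coordinates. The phases combine to
  -- the frequency `∑ bᵢ αᵢ` in `n`, ready for Poisson summation in `n` after the swap.
  have hinner : ∀ n : ℤ, ((∑' z : Fin d → ℤ, ω (Fin.last d) ((n : ℝ) / N) *
      ∏ i : Fin d, ω i.castSucc (((z i : ℝ) + n * α i - B.γ i) / B.ρ i) : ℝ) : ℂ) =
      ∑' b : Fin d → ℤ, (∏ i, A i (b i)) * ((ω (Fin.last d) ((n : ℝ) / N) : ℂ) *
        Complex.exp (2 * Real.pi * Complex.I * (n * (∑ i, b i * α i : ℝ)))) := by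
    intro n
    obtain ⟨-, h1⟩ := summable_norm_prod_and_tsum_prod
      (fun i (a : ℤ) => ω (Fin.castSucc i) (((n * α i - B.γ i) + a) / B.ρ i)) fun i =>
        (summable_of_hasFiniteSupport (L := SummationFilter.unconditional _) (hsup n i)).norm
    obtain ⟨-, h2⟩ := summable_norm_prod_and_tsum_prod
      (fun i b => A i b * Complex.exp (2 * Real.pi * Complex.I * b * (n * α i : ℝ))) fun i => by
        simp only [hAexp]
        exact hA i
    simp only [hpoint]
    rw [tsum_mul_left, h1]
    push_cast
    have h3 : ∀ i : Fin d, ∑' a : ℤ, (ω i.castSucc (((n * α i - B.γ i) + a) / B.ρ i) : ℂ) =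
        ∑' b, A i b * Complex.exp (2 * Real.pi * Complex.I * b * (n * α i : ℝ)) := by
      intro i
      refine (tsum_comp_div_eq (hω.contDiff_ofReal i.castSucc)
        (hω.hasCompactSupport_ofReal i.castSucc) (B.ρ_mem i).1 _).trans (tsum_congr fun b => ?_)
      simp only [A]
      rw [mul_assoc _ (Complex.exp _), ← Complex.exp_add, fourierHat]
      congr 2
      push_cast
      ring
    simp only [h3]
    rw [← h2, ← tsum_mul_left]
    refine tsum_congr fun b => ?_
    rw [Finset.prod_mul_distrib, ← Complex.exp_sum, mul_left_comm]
    congr 3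
    push_cast
    rw [Finset.mul_sum, Finset.mul_sum]
    refine Finset.sum_congr rfl fun i _ => ?_
    ring
  have hωs : Summable fun n : ℤ => ‖(ω (Fin.last d) ((n : ℝ) / N) : ℂ)‖ := by
    refine summable_of_hasFiniteSupport ((Set.finite_Icc (-(2 * N : ℤ)) (2 * N)).subset
      fun n hn => ?_)
    have h3 : |(n : ℝ)| ≤ 2 * N := by
      by_contra! h
      refine hn ?_
      simp only [Complex.norm_real, norm_eq_zero]
      refine hω.eq_zero_of_lt _ ?_
      rwa [abs_div, abs_of_pos hN0, lt_div_iff₀ hN0]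
    exact abs_le.mp (by exact_mod_cast h3)
  have hswap : Summable (Function.uncurry fun (n : ℤ) (b : Fin d → ℤ) =>
      (∏ i, A i (b i)) * ((ω (Fin.last d) ((n : ℝ) / N) : ℂ) *
        Complex.exp (2 * Real.pi * Complex.I * (n * (∑ i, b i * α i : ℝ))))) := by
    refine Summable.of_norm ((hωs.mul_norm hAs).congr fun q => ?_)
    have := norm_exp_two_pi_I_mul_int_mul q.1 (∑ i, q.2 i * α i : ℝ)
    rw [mul_assoc (2 * Real.pi * Complex.I : ℂ)] at this
    simp only [Function.uncurry, norm_mul, this, mul_one]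
    ring
  calc _ = ((∑' (n : ℤ), ∑' z : Fin d → ℤ, ω (Fin.last d) ((n : ℝ) / N) *
      ∏ i : Fin d, ω i.castSucc (((z i : ℝ) + n * α i - B.γ i) / B.ρ i) : ℝ) : ℂ) := by
        congr 1
        rw [← e.tsum_eq]
        refine hs.tsum_prod.trans (tsum_congr fun n => tsum_congr fun z => ?_)
        simp [e, Fin.snocEquiv]
    _ = ∑' n : ℤ, ∑' b : Fin d → ℤ, (∏ i, A i (b i)) * ((ω (Fin.last d) ((n : ℝ) / N) : ℂ) *
        Complex.exp (2 * Real.pi * Complex.I * (n * (∑ i, b i * α i : ℝ)))) := by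
        rw [Complex.ofReal_tsum]
        exact tsum_congr hinner
    _ = ∑' b : Fin d → ℤ, ∑' n : ℤ, (∏ i, A i (b i)) * ((ω (Fin.last d) ((n : ℝ) / N) : ℂ) *
        Complex.exp (2 * Real.pi * Complex.I * (n * (∑ i, b i * α i : ℝ)))) := hswap.tsum_comm.symm
    _ = ∑' b : Fin d → ℤ, ∑' m : ℤ, dualTerm ω α B N (b, m) := by
        refine tsum_congr fun b => ?_
        rw [tsum_mul_left, tsum_comp_div_mul_exp_eq (hω.contDiff_ofReal (Fin.last d))
          (hω.hasCompactSupport_ofReal _) hN0, ← tsum_mul_left]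
        refine tsum_congr fun m => ?_
        rw [dualTerm, fourierHat, Complex.ofReal_natCast]
    _ = _ := hsum.tsum_prod.symm

/-- The zero frequency is the expected count, so the discrepancy is the sum over the others. -/
theorem dualTerm_zero {d : ℕ} {ω : Fin (d + 1) → ℝ → ℝ} (hω : IsWeight 3 ω) (α : Fin d → ℝ)
    (B : Box d) (N : ℕ) : dualTerm ω α B N 0 = ((expectWeight ω * B.vol N : ℝ) : ℂ) := by
  have hre : ∀ i, fourierHat (ω i) 0 = ((fourierHat (ω i) 0).re : ℂ) := fun i =>
    Complex.ext rfl (Complex.lt_def.mp (hω.fourierHat_zero_pos i)).2.symm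
  simp only [dualTerm, Prod.fst_zero, Prod.snd_zero, Pi.zero_apply, Int.cast_zero, mul_zero,
    zero_mul, Complex.exp_zero, mul_one, Finset.sum_const_zero, sub_zero, expectWeight, Box.vol]
  rw [Fin.prod_univ_castSucc, Finset.prod_mul_distrib]
  push_cast
  simp only [← hre]
  ring

/-! ### Bounded discrepancy -/

/-- If the dual linear form is multiplicatively bounded from below, then the smooth discrepancies
in boxes are uniformly bounded. -/
theorem IsWeight.exists_abs_boxDiscrepancy_le {d : ℕ} {ω : Fin (d + 1) → ℝ → ℝ}
    (hω : IsWeight 3 ω) {α : Fin d → ℝ} {c : ℝ} (hc : 0 < c)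
    (hα : ∀ (b : Fin d → ℤ) (m : ℤ), (b ≠ 0 ∨ m ≠ 0) →
      c ≤ |m - ∑ i, b i * α i| * ∏ i, max 1 |(b i : ℝ)|) :
    ∃ D : ℝ, ∀ (B : Box d) (N : ℕ), 1 ≤ N → |boxDiscrepancy ω α B N| ≤ D := by
  classical
  obtain ⟨C, hC, hhat⟩ := hω.exists_norm_fourierHat_le
  set S := ∑' n : ℤ, 4 * ((1 + |(n : ℝ)|) ^ 2)⁻¹
  have hS : 0 ≤ S := tsum_nonneg fun n => by positivity
  refine ⟨C ^ (d + 1) * S ^ (d + 1) * (2 / c), fun B N hN => ?_⟩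
  have hN0 : (0 : ℝ) < N := by exact_mod_cast hN
  set V := (∏ i, B.ρ i) * (N : ℝ)
  have hvol : B.vol N = V := rfl
  have hV : 0 < V := mul_pos (Finset.prod_pos fun i _ => (B.ρ_mem i).1) hN0
  -- With this `J` each unit cell is split finely enough for injectivity, and `J + 1 ≤ 1 / (c * V) +
  -- 1`.
  set J := ⌊1 / (c * V)⌋₊
  have hJ : 1 ≤ (J + 1 : ℕ) * (c * V) := by
    have := Nat.lt_floor_add_one (1 / (c * V))
    rw [div_lt_iff₀ (by positivity)] at this
    push_cast
    exact this.le
  have hJ' : ((J + 1 : ℕ) : ℝ) ≤ 1 / (c * V) + 1 := by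
    push_cast
    gcongr
    exact Nat.floor_le (by positivity)
  obtain ⟨hW, hWle⟩ := summable_dualWeight_and_tsum_le hα B.ρ_mem hN0 hJ
  have hterm := norm_dualTerm_le hC hhat α B N
  have hw1 := one_le_dualWeight α B.ρ N
  have hsumn : Summable fun p => ‖dualTerm ω α B N p‖ := by
    refine Summable.of_nonneg_of_le (fun _ => norm_nonneg _) (fun p => (hterm p).trans ?_)
      (hW.mul_left (B.vol N * C ^ (d + 1)))
    rw [div_eq_mul_inv]
    have h0 := B.vol_nonneg N
    have := hw1 p
    gcongr
    norm_num
  set κ := min 1 (1 / (c * V))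
  have hκ : 0 ≤ κ := by positivity
  have hbound : ∀ p, ‖(if p = 0 then 0 else dualTerm ω α B N p)‖ ≤
      V * C ^ (d + 1) * κ * (dualWeight α B.ρ N p ^ 2)⁻¹ := by
    intro p
    have h1 := hw1 p
    split_ifs with hp
    · rw [norm_zero]; positivity
    · refine (hterm p).trans ?_
      have h2 : 1 / dualWeight α B.ρ N p ≤ κ := by
        refine le_min ?_ ?_
        · rw [div_le_one (by linarith)]; exact h1
        · exact one_div_le_one_div_of_le (by positivity) (le_dualWeight hα B.ρ_mem hN0 hp)
      calc _ = V * C ^ (d + 1) * (1 / dualWeight α B.ρ N p) * (dualWeight α B.ρ N p ^ 2)⁻¹ := by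
            rw [hvol]; field_simp
        _ ≤ _ := by gcongr
  have hite : Summable fun p => ‖(if p = 0 then 0 else dualTerm ω α B N p)‖ :=
    Summable.of_nonneg_of_le (fun _ => norm_nonneg _) hbound (hW.mul_left _)
  have hdisc : (boxDiscrepancy ω α B N : ℂ) =
      ∑' p, if p = 0 then 0 else dualTerm ω α B N p := by
    rw [boxDiscrepancy, Complex.ofReal_sub, hω.tsum_count_eq α B hN hsumn.of_norm,
      hsumn.of_norm.tsum_eq_add_tsum_ite 0, dualTerm_zero hω, add_sub_cancel_left]
  rw [← Real.norm_eq_abs, ← Complex.norm_real, hdisc]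
  -- If `c * V ≤ 1`, the prefactor `V` absorbs the crowding `J + 1` of the cells; if `c * V ≥ 1`,
  -- then `J + 1 ≤ 2` and the gain `κ` absorbs `V`.
  have hVκ : V * κ * (J + 1 : ℕ) ≤ 2 / c := by
    rcases le_total 1 (1 / (c * V)) with h | h
    · calc V * κ * (J + 1 : ℕ) ≤ V * 1 * (1 / (c * V) + 1 / (c * V)) := by
            gcongr
            · exact min_le_left _ _
            · linarith
        _ = 2 / c := by field_simp; norm_num
    · calc V * κ * (J + 1 : ℕ) ≤ V * (1 / (c * V)) * (1 + 1) := by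
            gcongr
            · exact min_le_right _ _
            · linarith
        _ = 2 / c := by field_simp; norm_num
  calc _ ≤ ∑' p, ‖(if p = 0 then 0 else dualTerm ω α B N p)‖ := norm_tsum_le_tsum_norm hite
    _ ≤ ∑' p, V * C ^ (d + 1) * κ * (dualWeight α B.ρ N p ^ 2)⁻¹ :=
        hite.tsum_le_tsum hbound (hW.mul_left _)
    _ ≤ V * C ^ (d + 1) * κ * ((J + 1 : ℕ) * S ^ (d + 1)) := by
        rw [tsum_mul_left]
        gcongr
    _ = C ^ (d + 1) * S ^ (d + 1) * (V * κ * (J + 1 : ℕ)) := by ring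
    _ ≤ _ := by gcongr

theorem not_hasUnboundedDiscrepancy {d : ℕ} {ω : Fin (d + 1) → ℝ → ℝ} (hω : IsWeight 3 ω)
    {α : Fin d → ℝ} {c : ℝ} (hc : 0 < c)
    (hα : ∀ n : ℕ, 0 < n → ∀ a : Fin d → ℤ, c ≤ n * ∏ i, |n * α i - a i|) :
    ¬ HasUnboundedDiscrepancy ω α := by
  obtain ⟨c', hc', hdual⟩ := exists_dual_bound α hc hα
  obtain ⟨D, hD⟩ := hω.exists_abs_boxDiscrepancy_le hc' hdual
  intro h
  obtain ⟨N, hN, hlt⟩ := h D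
  exact absurd hlt (not_lt.mpr (iSup_le fun B => EReal.coe_le_coe_iff.mpr (hD B N hN)))

end SmoothDiscrepancy

theorem theorem1p8 (d : ℕ) (hd : 2 ≤ d) :
    (SmoothDiscrepancy.LittlewoodConjecture d ↔
      ∀ α : Fin d → ℝ, ∀ ω : Fin (d + 1) → ℝ → ℝ, SmoothDiscrepancy.IsWeight 3 ω →
        SmoothDiscrepancy.HasUnboundedDiscrepancy ω α) ∧
    (SmoothDiscrepancy.LittlewoodConjecture d ↔
      ∀ α : Fin d → ℝ, ∃ ω : Fin (d + 1) → ℝ → ℝ, SmoothDiscrepancy.IsWeight 3 ω ∧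
        SmoothDiscrepancy.HasUnboundedDiscrepancy ω α) := by
  have h12 : SmoothDiscrepancy.LittlewoodConjecture d → ∀ α : Fin d → ℝ,
      ∀ ω : Fin (d + 1) → ℝ → ℝ, SmoothDiscrepancy.IsWeight 3 ω →
        SmoothDiscrepancy.HasUnboundedDiscrepancy ω α := fun h α ω hω =>
    SmoothDiscrepancy.hasUnboundedDiscrepancy_of_small_values hω (h.exists_lt α)
  have h23 : (∀ α : Fin d → ℝ, ∀ ω : Fin (d + 1) → ℝ → ℝ, SmoothDiscrepancy.IsWeight 3 ω →
        SmoothDiscrepancy.HasUnboundedDiscrepancy ω α) → ∀ α : Fin d → ℝ,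
      ∃ ω : Fin (d + 1) → ℝ → ℝ, SmoothDiscrepancy.IsWeight 3 ω ∧
        SmoothDiscrepancy.HasUnboundedDiscrepancy ω α := fun h α => by
    obtain ⟨ω, hω⟩ := SmoothDiscrepancy.exists_isWeight (d + 1)
    exact ⟨ω, hω, h α ω hω⟩
  have h31 : (∀ α : Fin d → ℝ, ∃ ω : Fin (d + 1) → ℝ → ℝ, SmoothDiscrepancy.IsWeight 3 ω ∧
        SmoothDiscrepancy.HasUnboundedDiscrepancy ω α) →
      SmoothDiscrepancy.LittlewoodConjecture d := fun h α => by
    by_contra hne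
    obtain ⟨c, hc, hlow⟩ := SmoothDiscrepancy.exists_lower_bound_of_liminf_ne α hne
    obtain ⟨ω, hω, hunb⟩ := h α
    exact SmoothDiscrepancy.not_hasUnboundedDiscrepancy hω hc hlow hunb
  exact ⟨⟨h12, fun h => h31 (h23 h)⟩, ⟨fun h => h23 (h12 h), h31⟩⟩
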